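/- Let $L,T,\varepsilon>0$, $\Omega=(0,L)^2$, and consider $u_t=\varepsilon^2\Delta u+f(u)$ with periodic boundary conditions and initial value $u_{\rm init}$, where for some $\beta>0$ the function $f$ is continuously differentiable in a neighbourhood of each point of $[-\beta,\beta]$, $f(\beta)\le 0\le f(-\beta)$, and $F'=-f$ on $[-\beta,\beta]$. Let $C_*\ge 0$ be such that $|\Omega|F(\xi)\ge -C_*$ for $|\xi|\le\beta$ (equivalently, $E_1(v):=\int_\Omega F(v)\,dx\ge -C_*$ for all measurable $v$ with $|v|\le\beta$). For an integer $M\ge1$ let $h=L/M$, and for $M$-periodic grid functions $v,w$ on the mesh points $(ih,jh)$ let $\langle v,w\rangle=h^2\sum_{i,j=1}^M v_{ij}w_{ij}$, $\|v\|=\langle v,v\rangle^{1/2}$, let $\Delta_h$ be the five-point Laplacian, $\nabla_h v_{ij}=\big(\frac{v_{i+1,j}-v_{ij}}h,\frac{v_{i,j+1}-v_{ij}}h\big)$ with $\|(v^1,v^2)\|^2=\|v^1\|^2+\|v^2\|^2$, $E_{1h}(v)=\langle F(v),1\rangle$ and $g(v,s)=e^{s}/e^{E_{1h}(v)}$. For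 a time step $\tau>0$ and a stabilizing constant $\kappa$ the sESAV1 scheme is $$\frac{u^{n+1}-u^n}{\tau}=\varepsilon^2\Delta_hu^{n+1}+g(u^n,s^n)f(u^n)-\kappa g(u^n,s^n)(u^{n+1}-u^n),$$ $$\frac{s^{n+1}-s^n}{\tau}=-g(u^n,s^n)\Big\langle f(u^n),\frac{u^{n+1}-u^n}{\tau}\Big\rangle,$$ started from the restriction $u^0$ of $u_{\rm init}$ to the mesh and $s^0=E_{1h}(u^0)$. **Theorem (error estimate of sESAV1).** Suppose that the exact solution $u_e$ is smooth enough on $[0,T]\times\overline\Omega$, namely that its periodic extension has continuous time derivatives up to order $2$ and continuous space derivatives up to order $4$ on $[0,T]\times\mathbb R^2$. Assume $\kappa\ge\|f'\|_{C[-\beta,\beta]}$ and $\max_{\overline\Omega}|u_{\rm init}|\le\beta$. Put $t_n=n\tau$, $e_u^n=u^n-u_e(t_n)$ (at the mesh points) and $e_s^n=s^n-E_1(u_e(t_n))$. Then there is a constant $C>0$, depending only on $C_*$, $L$, $T$, $u_e$, $\kappa$, $\varepsilon$ and (an upper bound for) $\|f\|_{C^1[-\beta,\beta]}$, and in particular independent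 of $\tau$ and $h$, such that for all sufficiently small $\tau$ and $h=L/M$ $$\|e_u^n\|+\|\nabla_he_u^n\|+|e_s^n|\le C(\tau+h^2),\qquad 0\le n\le\lfloor T/\tau\rfloor .$$ -/

import Mathlib

namespace SESAV

noncomputable section

/-- The plane containing the square `Ω = (0,L) × (0,L)`. -/
abbrev Plane := EuclideanSpace ℝ (Fin 2)

/-- The open square `(0,L) × (0,L)`. -/
def square (L : ℝ) : Set Plane := {x | ∀ i, x i ∈ Set.Ioo 0 L}

/-- `L`-periodicity in both coordinate directions. A function on the closed square with periodic
boundary conditions is identified with its periodic extension to the plane. -/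
def IsPeriodic (L : ℝ) (φ : Plane → ℝ) : Prop :=
  ∀ x : Plane, φ (x + !₂[L, 0]) = φ x ∧ φ (x + !₂[0, L]) = φ x

/-- Regularity of a space-time function on `[0,T] × ℝ²`: two continuous time derivatives
and four continuous space derivatives (continuity is joint in time and space). -/
structure IsSmoothEnough (T : ℝ) (u : ℝ → Plane → ℝ) : Prop where
  time_contDiff : ∀ x, ContDiffOn ℝ 2 (fun t => u t x) (Set.Icc 0 T)
  time_continuous : ∀ k ≤ 2, ContinuousOn
    (fun p : ℝ × Plane => iteratedDerivWithin k (fun t => u t p.2) (Set.Icc 0 T) p.1)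
    (Set.Icc 0 T ×ˢ Set.univ)
  space_contDiff : ∀ t ∈ Set.Icc 0 T, ContDiff ℝ 4 (u t)
  space_continuous : ∀ k ≤ 4, ContinuousOn
    (fun p : ℝ × Plane => iteratedFDeriv ℝ k (u p.1) p.2) (Set.Icc 0 T ×ˢ Set.univ)

/-- `u` solves `u_t = ε² Δu + f(u)` on `(0,T]` with periodic boundary conditions and
initial value `uinit`. -/
structure IsSolution (L T ε : ℝ) (f : ℝ → ℝ) (uinit : Plane → ℝ) (u : ℝ → Plane → ℝ) :
    Prop where
  initial : u 0 = uinit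
  periodic : ∀ t ∈ Set.Icc 0 T, IsPeriodic L (u t)
  equation : ∀ t ∈ Set.Ioc 0 T, ∀ x,
    HasDerivWithinAt (fun s => u s x)
      (ε ^ 2 * Laplacian.laplacian (u t) x + f (u t x)) (Set.Icc 0 T) t

/-- The bulk part of the energy, `E₁(v) = ∫_Ω F(v(x)) dx`. -/
def bulkEnergy (L : ℝ) (F : ℝ → ℝ) (v : Plane → ℝ) : ℝ :=
  ∫ x in square L, F (v x)

/-- Periodic grid functions on the uniform `M × M` mesh; indices are taken modulo `M`. -/
abbrev Grid (M : ℕ) := ZMod M → ZMod M → ℝ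

/-- The mesh size `h = L / M`. -/
def meshSize (L : ℝ) (M : ℕ) : ℝ := L / M

/-- Restriction of a periodic function to the mesh points `(i h, j h)`. The representatives
`0, …, M - 1` of the indices are used; by periodicity any others give the same values. -/
def restrict (L : ℝ) (M : ℕ) (φ : Plane → ℝ) : Grid M :=
  fun i j => φ !₂[(i.val : ℝ) * meshSize L M, (j.val : ℝ) * meshSize L M]

/-- The discrete inner product `h² ∑ v_ij w_ij`. -/
def gridInner (L : ℝ) (M : ℕ) [NeZero M] (v w : Grid M) : ℝ :=
  meshSize L M ^ 2 * ∑ i, ∑ j, v i j * w i j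

/-- The discrete `L²` norm. -/
def gridNorm (L : ℝ) (M : ℕ) [NeZero M] (v : Grid M) : ℝ :=
  Real.sqrt (gridInner L M v v)

/-- The five-point discrete Laplacian. -/
def gridLaplacian (L : ℝ) (M : ℕ) (v : Grid M) : Grid M :=
  fun i j => 1 / meshSize L M ^ 2 *
    (v (i + 1) j + v (i - 1) j + v i (j + 1) + v i (j - 1) - 4 * v i j)

/-- The discrete gradient, by forward differences. -/
def gridGrad (L : ℝ) (M : ℕ) (v : Grid M) : Grid M × Grid M :=
  (fun i j => (v (i + 1) j - v i j) / meshSize L M,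
   fun i j => (v i (j + 1) - v i j) / meshSize L M)

/-- The discrete `L²` norm of a pair of grid functions. -/
def gridNormVec (L : ℝ) (M : ℕ) [NeZero M] (v : Grid M × Grid M) : ℝ :=
  Real.sqrt (gridInner L M v.1 v.1 + gridInner L M v.2 v.2)

/-- The discrete bulk energy `E₁ₕ(v) = ⟨F(v), 1⟩`. -/
def gridBulkEnergy (L : ℝ) (M : ℕ) [NeZero M] (F : ℝ → ℝ) (v : Grid M) : ℝ :=
  gridInner L M (fun i j => F (v i j)) (fun _ _ => 1)

/-- The coefficient `g(v,s) = exp(s) / exp(E₁ₕ(v))`. -/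
def coeff (L : ℝ) (M : ℕ) [NeZero M] (F : ℝ → ℝ) (v : Grid M) (s : ℝ) : ℝ :=
  Real.exp s / Real.exp (gridBulkEnergy L M F v)

/-- The pair of sequences `(U, S)` is generated by the first-order stabilized exponential-SAV
scheme with time step `τ`, stabilizing constant `κ` and initial value `uinit`. -/
structure IsSESAV1 (L : ℝ) (M : ℕ) [NeZero M] (ε κ τ : ℝ) (f F : ℝ → ℝ)
    (uinit : Plane → ℝ) (U : ℕ → Grid M) (S : ℕ → ℝ) : Prop where
  init_u : U 0 = restrict L M uinit
  init_s : S 0 = gridBulkEnergy L M F (U 0)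
  step_u : ∀ n i j,
    (U (n + 1) i j - U n i j) / τ
      = ε ^ 2 * gridLaplacian L M (U (n + 1)) i j
        + coeff L M F (U n) (S n) * f (U n i j)
        - κ * coeff L M F (U n) (S n) * (U (n + 1) i j - U n i j)
  step_s : ∀ n,
    (S (n + 1) - S n) / τ
      = - coeff L M F (U n) (S n)
          * gridInner L M (fun i j => f (U n i j)) (fun i j => (U (n + 1) i j - U n i j) / τ)

end

end SESAV

/-!
The proof is an energy estimate closed by a bootstrap. Write `e = U - u_e` for the error at the mesh
points and `z = S - E₁ₕ(U)` for the defect of the auxiliary variable, so that the coefficient of the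
scheme is `g = exp z`, and let `δ = τ + h²`.

* Both the scheme (`IsSESAV1.abs_le`, by the discrete maximum principle and the monotonicity of
  `κ ξ + f ξ`) and the exact solution (`IsSolution.mem_Icc`, by a barrier argument) stay in
  `[-β, β]`, where `f` is bounded and Lipschitz and `F` is a potential of `-f`.
* The exact solution satisfies the unstabilized scheme up to `O(δ)` (`abs_consistency_error_le`).
  Testing the error equation with the increment of `e`, whose norm is `d`, controls `‖∇ₕe‖²` and
  gains `d²/τ`, at the cost of a source of size `z² + ‖e‖² + δ²` (`IsSESAV1.error_energy_le`).
* Instead of comparing `S` with `E₁(u_e)` directly, one follows `z`. It starts from zero, and since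
  the update of `S` is `-g ⟨f(U), ΔU⟩` while `E₁ₕ(U)` changes by `-⟨f(U), ΔU⟩` up to a quadratic
  term, `z` changes only by `(1 - g) ⟨f(U), ΔU⟩` and that quadratic term, which the gain `d²/τ`
  absorbs (`IsSESAV1.abs_defect_sub_le`, `energy_recursion`).
* As long as `A = ‖e‖² + ε²‖∇ₕe‖² + z²` is at most one, `g` is bounded and `A` grows by a factor
  `1 + O(τ)` and a source `O(τ δ²)` per step. The Gronwall bound `A ≤ E δ²` is below one for small
  `δ`, so the condition `A ≤ 1` propagates (`bootstrap_gronwall`). Of the nonlinearity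
  only the bound for `f` and `f'` enters the constants; `β` and `F` do not.
* Finally `S - E₁(u_e)` is `z` plus the difference of the discrete energies of `U` and `u_e`, bounded
  by `‖e‖`, plus the quadrature error, which is `O(h²)` because on periodic functions the rectangle
  rule is the trapezoidal rule (`abs_bulkEnergy_sub_gridBulkEnergy_le`).
-/

namespace SESAV

/-! ### One-variable estimates -/

theorem abs_le_pow_succ_of_hasDerivAt {P P' : ℝ → ℝ} {h c : ℝ} (k : ℕ) (hc : 0 ≤ c)
    (hP : ∀ s ∈ Set.Icc 0 h, HasDerivAt P (P' s) s) (h0 : P 0 = 0)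
    (hb : ∀ s ∈ Set.Icc 0 h, |P' s| ≤ c * s ^ k) :
    ∀ s ∈ Set.Icc 0 h, |P s| ≤ c * s ^ (k + 1) := by
  intro s hs
  have hsub : Set.Icc 0 s ⊆ Set.Icc 0 h := Set.Icc_subset_Icc_right hs.2
  have := (convex_Icc 0 s).norm_image_sub_le_of_norm_hasDerivWithin_le (f := P) (f' := P')
    (C := c * s ^ k) (x := 0) (y := s)
    (fun r hr => (hP r (hsub hr)).hasDerivWithinAt)
    (fun r hr => (hb r (hsub hr)).trans
      (mul_le_mul_of_nonneg_left (pow_le_pow_left₀ hr.1 hr.2 k) hc))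
    ⟨le_rfl, hs.1⟩ ⟨hs.1, le_rfl⟩
  simp only [h0, sub_zero, Real.norm_eq_abs, abs_of_nonneg hs.1] at this
  rw [pow_succ, ← mul_assoc]
  exact this

/-- The centred second difference quotient is second-order accurate. -/
theorem abs_second_difference_sub_le {D₀ D₁ D₂ D₃ D₄ : ℝ → ℝ} {h B : ℝ} (hh : 0 ≤ h)
    (h₀ : ∀ s ∈ Set.Icc (-h) h, HasDerivAt D₀ (D₁ s) s)
    (h₁ : ∀ s ∈ Set.Icc (-h) h, HasDerivAt D₁ (D₂ s) s)
    (h₂ : ∀ s ∈ Set.Icc (-h) h, HasDerivAt D₂ (D₃ s) s)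
    (h₃ : ∀ s ∈ Set.Icc (-h) h, HasDerivAt D₃ (D₄ s) s)
    (hB : ∀ s ∈ Set.Icc (-h) h, |D₄ s| ≤ B) :
    |D₀ h + D₀ (-h) - 2 * D₀ 0 - h ^ 2 * D₂ 0| ≤ 2 * B * h ^ 4 := by
  have hp : ∀ s ∈ Set.Icc 0 h, s ∈ Set.Icc (-h) h := fun s hs => ⟨by linarith [hs.1], hs.2⟩
  have hn : ∀ s ∈ Set.Icc 0 h, -s ∈ Set.Icc (-h) h :=
    fun s hs => ⟨by linarith [hs.2], by linarith [hs.1]⟩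
  have hB0 : 0 ≤ B := (abs_nonneg _).trans (hB 0 ⟨by linarith, hh⟩)
  have rev : ∀ {D D' : ℝ → ℝ}, (∀ s ∈ Set.Icc (-h) h, HasDerivAt D (D' s) s) →
      ∀ s ∈ Set.Icc 0 h, HasDerivAt (fun r => D (-r)) (-D' (-s)) s := by
    intro D D' hD s hs
    exact (HasDerivAt.scomp s (hD _ (hn s hs)) (hasDerivAt_neg s)).congr_deriv (by simp)
  have e₃ := abs_le_pow_succ_of_hasDerivAt (P := fun s => D₃ s - D₃ (-s))
    (P' := fun s => D₄ s + D₄ (-s)) (h := h) (c := 2 * B) 0 (by positivity)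
    (fun s hs => ((h₃ s (hp s hs)).sub (rev h₃ s hs)).congr_deriv (by simp)) (by simp)
    (fun s hs => by
      have := abs_add_le (D₄ s) (D₄ (-s))
      have := hB s (hp s hs)
      have := hB _ (hn s hs)
      simp only [pow_zero, mul_one]; linarith)
  have e₂ := abs_le_pow_succ_of_hasDerivAt (P := fun s => D₂ s + D₂ (-s) - 2 * D₂ 0)
    (P' := fun s => D₃ s - D₃ (-s)) (h := h) (c := 2 * B) 1 (by positivity)
    (fun s hs => (((h₂ s (hp s hs)).add (rev h₂ s hs)).sub_const (2 * D₂ 0)).congr_deriv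
      (by ring))
    (by simp; ring) e₃
  have e₁ := abs_le_pow_succ_of_hasDerivAt (P := fun s => D₁ s - D₁ (-s) - s * (2 * D₂ 0))
    (P' := fun s => D₂ s + D₂ (-s) - 2 * D₂ 0) (h := h) (c := 2 * B) 2 (by positivity)
    (fun s hs => (((h₁ s (hp s hs)).sub (rev h₁ s hs)).sub
      ((hasDerivAt_id s).mul_const (2 * D₂ 0))).congr_deriv (by ring))
    (by simp) e₂
  have e₀ := abs_le_pow_succ_of_hasDerivAt
    (P := fun s => D₀ s + D₀ (-s) - s ^ 2 * D₂ 0 - 2 * D₀ 0)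
    (P' := fun s => D₁ s - D₁ (-s) - s * (2 * D₂ 0)) (h := h) (c := 2 * B) 3 (by positivity)
    (fun s hs => by
      have := (((h₀ s (hp s hs)).add (rev h₀ s hs)).sub
        (((hasDerivAt_id s).pow 2).mul_const (D₂ 0))).sub_const (2 * D₀ 0)
      refine this.congr_deriv ?_
      simp; ring)
    (by simp; ring) e₁ h ⟨hh, le_rfl⟩
  calc _ = |D₀ h + D₀ (-h) - h ^ 2 * D₂ 0 - 2 * D₀ 0| := by congr 1; ring
    _ ≤ _ := e₀

/-- The backward difference quotient is first-order accurate, in the form with the time step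
multiplied out. -/
theorem abs_backward_difference_sub_le {ψ ψ' ψ'' : ℝ → ℝ} {T a b B : ℝ}
    (h₀ : ∀ s ∈ Set.Icc 0 T, HasDerivWithinAt ψ (ψ' s) (Set.Icc 0 T) s)
    (h₁ : ∀ s ∈ Set.Icc 0 T, HasDerivWithinAt ψ' (ψ'' s) (Set.Icc 0 T) s)
    (hB : ∀ s ∈ Set.Icc 0 T, |ψ'' s| ≤ B) (ha : 0 ≤ a) (hab : a ≤ b) (hb : b ≤ T) :
    |ψ b - ψ a - (b - a) * ψ' b| ≤ B * (b - a) ^ 2 := by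
  have hsub : Set.Icc a b ⊆ Set.Icc 0 T := Set.Icc_subset_Icc ha hb
  have hB0 : 0 ≤ B := (abs_nonneg _).trans (hB b (hsub ⟨hab, le_rfl⟩))
  have e₁ : ∀ s ∈ Set.Icc a b, |ψ' s - ψ' b| ≤ B * (b - a) := by
    intro s hs
    have := (convex_Icc 0 T).norm_image_sub_le_of_norm_hasDerivWithin_le h₁ hB
      (hsub ⟨hab, le_rfl⟩) (hsub hs)
    refine this.trans (mul_le_mul_of_nonneg_left ?_ hB0)
    rw [Real.norm_eq_abs, abs_sub_comm, abs_of_nonneg (by linarith [hs.2])]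
    linarith [hs.1]
  have := (convex_Icc a b).norm_image_sub_le_of_norm_hasDerivWithin_le
    (f := fun s => ψ s - s * ψ' b) (f' := fun s => ψ' s - ψ' b)
    (fun s hs => (((h₀ s (hsub hs)).mono hsub).sub
      ((hasDerivWithinAt_id s (Set.Icc a b)).mul_const (ψ' b))).congr_deriv (by ring))
    e₁ ⟨le_rfl, hab⟩ ⟨hab, le_rfl⟩
  rw [Real.norm_eq_abs, Real.norm_eq_abs, abs_of_nonneg (sub_nonneg.2 hab)] at this
  calc _ = |ψ b - b * ψ' b - (ψ a - a * ψ' b)| := by congr 1; ring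
    _ ≤ _ := this
    _ = _ := by ring

/-- The trapezoidal rule on one cell. -/
theorem abs_integral_sub_trapezoid_le {φ φ' φ'' : ℝ → ℝ} {a h B : ℝ} (hh : 0 ≤ h)
    (h₀ : ∀ s ∈ Set.Icc a (a + h), HasDerivAt φ (φ' s) s)
    (h₁ : ∀ s ∈ Set.Icc a (a + h), HasDerivAt φ' (φ'' s) s)
    (hB : ∀ s ∈ Set.Icc a (a + h), |φ'' s| ≤ B) :
    |(∫ x in a..(a + h), φ x) - h * (φ a + φ (a + h)) / 2| ≤ B * h ^ 3 := by
  have hB0 : 0 ≤ B := (abs_nonneg _).trans (hB a ⟨le_rfl, by linarith⟩)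
  have hcont : ContinuousOn φ (Set.Icc a (a + h)) :=
    fun s hs => (h₀ s hs).continuousAt.continuousWithinAt
  have mem : ∀ s ∈ Set.Icc 0 h, a + s ∈ Set.Icc a (a + h) :=
    fun s hs => ⟨by linarith [hs.1], by linarith [hs.2]⟩
  have hint : ∀ s ∈ Set.Icc 0 h, |φ (a + s) - φ a - s * φ' (a + s)| ≤ B * s ^ 2 := by
    intro s hs
    have := abs_le_pow_succ_of_hasDerivAt
      (P := fun r => φ (a + r) - φ a - r * φ' (a + r)) (P' := fun r => - (r * φ'' (a + r)))
      (h := h) (c := B) 1 hB0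
      (fun r hr => by
        have k₀ := (h₀ _ (mem r hr)).comp_const_add a r
        have k₁ := (h₁ _ (mem r hr)).comp_const_add a r
        refine ((k₀.sub_const (φ a)).sub ((hasDerivAt_id r).mul k₁)).congr_deriv ?_
        simp)
      (by simp)
      (fun r hr => by
        rw [abs_neg, abs_mul, abs_of_nonneg hr.1, pow_one, mul_comm]
        exact mul_le_mul_of_nonneg_right (hB _ (mem r hr)) hr.1) s hs
    simpa using this
  -- one-sided derivatives suffice: the primitive is only differentiated inside the cell
  have key := (convex_Icc 0 h).norm_image_sub_le_of_norm_hasDerivWithin_le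
    (f := fun s => (∫ x in a..(a + s), φ x) - s * (φ a + φ (a + s)) / 2)
    (f' := fun s => (φ (a + s) - φ a - s * φ' (a + s)) / 2) (C := B * h ^ 2)
    (x := 0) (y := h)
    (fun s hs => by
      have hI : HasDerivWithinAt (fun r => ∫ x in a..r, φ x) (φ (a + s)) (Set.Icc a (a + h))
          (a + s) := by
        have : Fact (a + s ∈ Set.Icc a (a + h)) := ⟨mem s hs⟩
        refine intervalIntegral.integral_hasDerivWithinAt_right
          (s := Set.Icc a (a + h)) (t := Set.Icc a (a + h)) ?_ ?_ ?_
        · refine (hcont.mono ?_).intervalIntegrable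
          rw [Set.uIcc_of_le (by linarith [hs.1])]
          exact Set.Icc_subset_Icc_right (by linarith [hs.2])
        · exact hcont.stronglyMeasurableAtFilter_nhdsWithin measurableSet_Icc _
        · exact hcont _ (mem s hs)
      have hI' : HasDerivWithinAt (fun r => ∫ x in a..(a + r), φ x) (φ (a + s))
          (Set.Icc 0 h) s := by
        have := hI.scomp (h := fun r => a + r) s ((hasDerivWithinAt_id s (Set.Icc 0 h)).const_add a)
          (fun r hr => mem r hr)
        simpa [Function.comp_def] using this
      have k₀ := ((h₀ _ (mem s hs)).comp_const_add a s).hasDerivWithinAt (s := Set.Icc 0 h)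
      refine (hI'.sub (((hasDerivWithinAt_id s (Set.Icc 0 h)).mul
        (k₀.const_add (φ a))).div_const 2)).congr_deriv ?_
      simp; ring)
    (fun s hs => by
      rw [Real.norm_eq_abs, abs_div, abs_two]
      have h1 := hint s hs
      have h2 : B * s ^ 2 ≤ B * h ^ 2 :=
        mul_le_mul_of_nonneg_left (pow_le_pow_left₀ hs.1 hs.2 2) hB0
      have := abs_nonneg (φ (a + s) - φ a - s * φ' (a + s))
      linarith)
    ⟨le_rfl, hh⟩ ⟨hh, le_rfl⟩
  simp only [add_zero, intervalIntegral.integral_same, zero_mul, zero_div, sub_zero,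
    Real.norm_eq_abs, abs_of_nonneg hh] at key
  calc _ ≤ _ := key
    _ = _ := by ring

/-- For a function with equal end values the rectangle rule is the trapezoidal rule, hence
second-order accurate. -/
theorem abs_integral_sub_rectangle_le {φ φ' φ'' : ℝ → ℝ} {L B : ℝ} (hL : 0 < L)
    (h₀ : ∀ s ∈ Set.Icc 0 L, HasDerivAt φ (φ' s) s)
    (h₁ : ∀ s ∈ Set.Icc 0 L, HasDerivAt φ' (φ'' s) s)
    (hB : ∀ s ∈ Set.Icc 0 L, |φ'' s| ≤ B) (hper : φ 0 = φ L) (M : ℕ) (hM : 0 < M) :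
    |(∫ x in (0 : ℝ)..L, φ x) - meshSize L M * ∑ i ∈ Finset.range M, φ (i * meshSize L M)|
      ≤ B * L * meshSize L M ^ 2 := by
  set h := meshSize L M with hdef
  have hM' : (0 : ℝ) < M := by exact_mod_cast hM
  have hh : 0 < h := by rw [hdef, meshSize]; positivity
  have hMh : M * h = L := by rw [hdef, meshSize]; field_simp
  have hcont : ContinuousOn φ (Set.Icc 0 L) :=
    fun s hs => (h₀ s hs).continuousAt.continuousWithinAt
  have cell : ∀ i < M, Set.Icc (i * h) (i * h + h) ⊆ Set.Icc 0 L := by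
    intro i hi
    refine Set.Icc_subset_Icc (by positivity) ?_
    have : ((i : ℝ) + 1) ≤ M := by exact_mod_cast hi
    nlinarith
  have hsum : (∫ x in (0 : ℝ)..L, φ x)
      = ∑ i ∈ Finset.range M, ∫ x in (i * h)..(i * h + h), φ x := by
    have := intervalIntegral.sum_integral_adjacent_intervals (f := φ)
      (μ := MeasureTheory.volume) (a := fun i : ℕ => (i : ℝ) * h) (n := M) (by
        intro i hi
        refine (hcont.mono ?_).intervalIntegrable
        have hle : (i : ℝ) * h ≤ ((i + 1 : ℕ) : ℝ) * h := by push_cast; nlinarith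
        rw [Set.uIcc_of_le hle]
        have e : ((i + 1 : ℕ) : ℝ) * h = i * h + h := by push_cast; ring
        rw [e]
        exact cell i hi)
    simp only [Nat.cast_zero, zero_mul, hMh] at this
    rw [← this]
    refine Finset.sum_congr rfl fun i _ => ?_
    congr 1; push_cast; rw [add_mul, one_mul]
  have hshift : ∑ i ∈ Finset.range M, φ (i * h + h) = ∑ i ∈ Finset.range M, φ (i * h) := by
    have e1 := Finset.sum_range_succ (fun i : ℕ => φ (i * h)) M
    have e2 := Finset.sum_range_succ' (fun i : ℕ => φ (i * h)) M
    simp only [hMh, Nat.cast_zero, zero_mul, Nat.cast_add, Nat.cast_one, add_mul, one_mul]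
      at e1 e2
    linarith
  have hrect : h * ∑ i ∈ Finset.range M, φ (i * h)
      = ∑ i ∈ Finset.range M, h * (φ (i * h) + φ (i * h + h)) / 2 := by
    rw [← Finset.sum_div, ← Finset.mul_sum, Finset.sum_add_distrib, hshift]; ring
  rw [hsum, hrect, ← Finset.sum_sub_distrib]
  calc _ ≤ ∑ i ∈ Finset.range M, B * h ^ 3 := by
        refine (Finset.abs_sum_le_sum_abs _ _).trans (Finset.sum_le_sum fun i hi => ?_)
        have hc := cell i (Finset.mem_range.1 hi)
        exact abs_integral_sub_trapezoid_le hh.le (fun s hs => h₀ s (hc hs))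
          (fun s hs => h₁ s (hc hs)) (fun s hs => hB s (hc hs))
    _ = B * (M * h) * h ^ 2 := by rw [Finset.sum_const, Finset.card_range, nsmul_eq_mul]; ring
    _ = _ := by rw [hMh]

/-! ### Grid functions -/

/-- The discrete integral `h² ∑ v_ij`. -/
noncomputable def gridSum (L : ℝ) (M : ℕ) [NeZero M] (v : Grid M) : ℝ :=
  meshSize L M ^ 2 * ∑ i, ∑ j, v i j

/-- The squared discrete `H¹` seminorm `‖∇ₕ v‖²`. -/
noncomputable def gradSq (L : ℝ) (M : ℕ) [NeZero M] (v : Grid M) : ℝ :=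
  gridInner L M (gridGrad L M v).1 (gridGrad L M v).1
    + gridInner L M (gridGrad L M v).2 (gridGrad L M v).2

section Grid

variable {L : ℝ} {M : ℕ}

theorem gridGrad_sub (v w : Grid M) : gridGrad L M (v - w) = gridGrad L M v - gridGrad L M w := by
  ext i j <;> simp [gridGrad] <;> ring

theorem gridLaplacian_neg (V : Grid M) (i j : ZMod M) :
    gridLaplacian L M (-V) i j = -gridLaplacian L M V i j := by
  simp only [gridLaplacian, Pi.neg_apply]; ring

theorem gridLaplacian_sub (V W : Grid M) (i j : ZMod M) :
    gridLaplacian L M (V - W) i j = gridLaplacian L M V i j - gridLaplacian L M W i j := by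
  simp only [gridLaplacian, Pi.sub_apply]; ring

variable [NeZero M]

theorem gridInner_eq_gridSum (v w : Grid M) :
    gridInner L M v w = gridSum L M (fun i j => v i j * w i j) := rfl

theorem gridBulkEnergy_eq_gridSum (F : ℝ → ℝ) (v : Grid M) :
    gridBulkEnergy L M F v = gridSum L M (fun i j => F (v i j)) := by
  simp [gridBulkEnergy, gridInner, gridSum]

theorem gridSum_add (v w : Grid M) :
    gridSum L M (fun i j => v i j + w i j) = gridSum L M v + gridSum L M w := by
  simp [gridSum, Finset.sum_add_distrib, mul_add]

theorem gridSum_sub (v w : Grid M) :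
    gridSum L M (fun i j => v i j - w i j) = gridSum L M v - gridSum L M w := by
  simp [gridSum, Finset.sum_sub_distrib, mul_sub]

theorem gridSum_mul_left (a : ℝ) (v : Grid M) :
    gridSum L M (fun i j => a * v i j) = a * gridSum L M v := by
  simp only [gridSum, ← Finset.mul_sum]; ring

theorem meshSize_mul (L : ℝ) (M : ℕ) [NeZero M] : M * meshSize L M = L := by
  have : (M : ℝ) ≠ 0 := Nat.cast_ne_zero.2 (NeZero.ne M)
  rw [meshSize]; field_simp

theorem meshSize_pos (hL : 0 < L) : 0 < meshSize L M := by
  have : (0 : ℝ) < M := Nat.cast_pos.2 (NeZero.pos M)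
  rw [meshSize]; positivity

theorem gridSum_const (a : ℝ) : gridSum L M (fun _ _ => a) = L ^ 2 * a := by
  simp only [gridSum, Finset.sum_const, Finset.card_univ, ZMod.card, nsmul_eq_mul]
  have := meshSize_mul L M
  calc _ = (M * meshSize L M) ^ 2 * a := by ring
    _ = _ := by rw [this]

theorem gridSum_mono {v w : Grid M} (h : ∀ i j, v i j ≤ w i j) :
    gridSum L M v ≤ gridSum L M w :=
  mul_le_mul_of_nonneg_left (Finset.sum_le_sum fun i _ => Finset.sum_le_sum fun j _ => h i j)
    (sq_nonneg _)

theorem abs_gridSum_le (v : Grid M) : |gridSum L M v| ≤ gridSum L M (fun i j => |v i j|) := by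
  rw [gridSum, gridSum, abs_mul, abs_of_nonneg (sq_nonneg (meshSize L M))]
  refine mul_le_mul_of_nonneg_left ?_ (sq_nonneg _)
  exact (Finset.abs_sum_le_sum_abs _ _).trans
    (Finset.sum_le_sum fun i _ => Finset.abs_sum_le_sum_abs _ _)

theorem gridInner_self_nonneg (v : Grid M) : 0 ≤ gridInner L M v v :=
  mul_nonneg (sq_nonneg _) (Finset.sum_nonneg fun _ _ =>
    Finset.sum_nonneg fun _ _ => mul_self_nonneg _)

theorem gradSq_nonneg (v : Grid M) : 0 ≤ gradSq L M v :=
  add_nonneg (gridInner_self_nonneg _) (gridInner_self_nonneg _)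

/-- The discrete `L¹` norm is controlled by the discrete `L²` norm. -/
theorem gridSum_abs_le (hL : 0 ≤ L) (v : Grid M) :
    gridSum L M (fun i j => |v i j|) ≤ L * Real.sqrt (gridInner L M v v) := by
  have hsq : L * Real.sqrt (gridInner L M v v) = Real.sqrt (L ^ 2 * gridInner L M v v) := by
    rw [Real.sqrt_mul (sq_nonneg L), Real.sqrt_sq hL]
  rw [hsq]
  refine Real.le_sqrt_of_sq_le ?_
  have key : (∑ p : ZMod M × ZMod M, |v p.1 p.2|) ^ 2
      ≤ (M : ℝ) ^ 2 * ∑ p : ZMod M × ZMod M, v p.1 p.2 * v p.1 p.2 := by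
    refine (sq_sum_le_card_mul_sum_sq (s := Finset.univ)
      (f := fun p : ZMod M × ZMod M => |v p.1 p.2|)).trans_eq ?_
    simp only [Finset.card_univ, Fintype.card_prod, ZMod.card, sq_abs]
    push_cast
    simp only [sq]
  simp only [Fintype.sum_prod_type] at key
  have hm := meshSize_mul L M
  rw [gridSum, gridInner, mul_pow]
  calc _ ≤ (meshSize L M ^ 2) ^ 2 * ((M : ℝ) ^ 2 * ∑ i, ∑ j, v i j * v i j) :=
        mul_le_mul_of_nonneg_left key (sq_nonneg _)
    _ = (M * meshSize L M) ^ 2 * (meshSize L M ^ 2 * ∑ i, ∑ j, v i j * v i j) := by ring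
    _ = _ := by rw [hm]

theorem sum_second_difference_mul (a b : ZMod M → ℝ) :
    ∑ i, (a (i + 1) + a (i - 1) - 2 * a i) * b i
      = -∑ i, (a (i + 1) - a i) * (b (i + 1) - b i) := by
  have e : ∑ i, (a (i + 1) - a i) * b (i + 1) = ∑ i, (a i - a (i - 1)) * b i := by
    rw [← Equiv.sum_comp (Equiv.addRight (1 : ZMod M)) (fun i => (a i - a (i - 1)) * b i)]
    simp
  have e' : ∑ i, (a (i + 1) - a i) * (b (i + 1) - b i)
      = ∑ i, (a i - a (i - 1)) * b i - ∑ i, (a (i + 1) - a i) * b i := by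
    rw [← e, ← Finset.sum_sub_distrib]
    exact Finset.sum_congr rfl fun i _ => by ring
  rw [e', ← Finset.sum_sub_distrib, ← Finset.sum_neg_distrib]
  exact Finset.sum_congr rfl fun i _ => by ring

/-- Summation by parts. -/
theorem gridInner_gridLaplacian (v w : Grid M) :
    gridInner L M (gridLaplacian L M v) w
      = -(gridInner L M (gridGrad L M v).1 (gridGrad L M w).1
          + gridInner L M (gridGrad L M v).2 (gridGrad L M w).2) := by
  have e₁ : ∑ i, ∑ j, (v (i + 1) j + v (i - 1) j - 2 * v i j) * w i j
      = -∑ i, ∑ j, (v (i + 1) j - v i j) * (w (i + 1) j - w i j) := by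
    rw [Finset.sum_comm, Finset.sum_comm (f := fun i j =>
      (v (i + 1) j - v i j) * (w (i + 1) j - w i j)), ← Finset.sum_neg_distrib]
    exact Finset.sum_congr rfl fun j _ =>
      sum_second_difference_mul (fun i => v i j) (fun i => w i j)
  have e₂ : ∑ i, ∑ j, (v i (j + 1) + v i (j - 1) - 2 * v i j) * w i j
      = -∑ i, ∑ j, (v i (j + 1) - v i j) * (w i (j + 1) - w i j) := by
    rw [← Finset.sum_neg_distrib]
    exact Finset.sum_congr rfl fun i _ => sum_second_difference_mul (v i) (w i)
  have eL : ∑ i, ∑ j, gridLaplacian L M v i j * w i j = 1 / meshSize L M ^ 2 *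
      (∑ i, ∑ j, (v (i + 1) j + v (i - 1) j - 2 * v i j) * w i j
        + ∑ i, ∑ j, (v i (j + 1) + v i (j - 1) - 2 * v i j) * w i j) := by
    simp only [← Finset.sum_add_distrib, Finset.mul_sum]
    exact Finset.sum_congr rfl fun i _ => Finset.sum_congr rfl fun j _ => by
      rw [gridLaplacian]; ring
  have g₁ : ∑ i, ∑ j, (gridGrad L M v).1 i j * (gridGrad L M w).1 i j = 1 / meshSize L M ^ 2 *
      ∑ i, ∑ j, (v (i + 1) j - v i j) * (w (i + 1) j - w i j) := by
    simp only [Finset.mul_sum]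
    exact Finset.sum_congr rfl fun i _ => Finset.sum_congr rfl fun j _ => by
      simp only [gridGrad]; ring
  have g₂ : ∑ i, ∑ j, (gridGrad L M v).2 i j * (gridGrad L M w).2 i j = 1 / meshSize L M ^ 2 *
      ∑ i, ∑ j, (v i (j + 1) - v i j) * (w i (j + 1) - w i j) := by
    simp only [Finset.mul_sum]
    exact Finset.sum_congr rfl fun i _ => Finset.sum_congr rfl fun j _ => by
      simp only [gridGrad]; ring
  rw [gridInner, gridInner, gridInner, eL, e₁, e₂, g₁, g₂]
  ring

/-- Polarization of the Dirichlet form: implicit Euler dissipates the Dirichlet energy. -/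
theorem gridInner_gridLaplacian_sub_le (v w : Grid M) :
    gridInner L M (gridLaplacian L M v) (v - w) ≤ -((gradSq L M v - gradSq L M w) / 2) := by
  have h : ∀ a b : Grid M, (gridInner L M a a - gridInner L M b b) / 2
      ≤ gridInner L M a (a - b) := by
    intro a b
    have : gridSum L M (fun i j => 1 / 2 * (a i j * a i j - b i j * b i j))
        ≤ gridSum L M (fun i j => a i j * (a - b) i j) :=
      gridSum_mono fun i j => by
        simp only [Pi.sub_apply]; nlinarith [sq_nonneg (a i j - b i j)]
    rw [gridSum_mul_left, gridSum_sub] at this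
    simp only [gridInner_eq_gridSum]
    linarith
  have h₁ := h (gridGrad L M v).1 (gridGrad L M w).1
  have h₂ := h (gridGrad L M v).2 (gridGrad L M w).2
  rw [gridInner_gridLaplacian, gridGrad_sub, gradSq, gradSq]
  simp only [Prod.fst_sub, Prod.snd_sub]
  linarith

/-- Energy estimate for one implicit Euler step of a heat equation with source `G` and a
stabilizing term of the good sign. -/
theorem heat_step_energy_le {ε τ c : ℝ} (hτ : 0 < τ) (hc : 0 ≤ c) {e e' G : Grid M}
    (h : ∀ i j, (e' i j - e i j) / τ
      = ε ^ 2 * gridLaplacian L M e' i j + G i j - c * (e' i j - e i j)) :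
    gridInner L M (e' - e) (e' - e) / τ + ε ^ 2 * (gradSq L M e' - gradSq L M e)
      ≤ τ * gridInner L M G G := by
  have hD := gridInner_gridLaplacian_sub_le (L := L) e' e
  have hε : 0 ≤ ε ^ 2 := sq_nonneg ε
  have key : gridSum L M (fun i j => (1 / (2 * τ)) * ((e' - e) i j * (e' - e) i j))
      ≤ gridSum L M (fun i j => ε ^ 2 * (gridLaplacian L M e' i j * (e' - e) i j)
        + (τ / 2) * (G i j * G i j)) := by
    refine gridSum_mono fun i j => ?_
    have hij := h i j
    simp only [Pi.sub_apply]
    set w := e' i j - e i j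
    set G₀ := G i j
    have hw : w / τ * w = ε ^ 2 * (gridLaplacian L M e' i j * w) + G₀ * w - c * w ^ 2 := by
      rw [hij]; ring
    have hy : G₀ * w ≤ τ / 2 * (G₀ * G₀) + 1 / (2 * τ) * (w * w) := by
      have : 0 ≤ (τ * G₀ - w) ^ 2 / (2 * τ) := by positivity
      have e : (τ * G₀ - w) ^ 2 / (2 * τ)
          = τ / 2 * (G₀ * G₀) + 1 / (2 * τ) * (w * w) - G₀ * w := by field_simp; ring
      linarith
    have hs : w / τ * w = 1 / (2 * τ) * (w * w) + 1 / (2 * τ) * (w * w) := by field_simp; ring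
    have : 0 ≤ c * w ^ 2 := by positivity
    linarith
  rw [gridSum_mul_left, gridSum_add, gridSum_mul_left, gridSum_mul_left] at key
  simp only [← gridInner_eq_gridSum] at key
  have := mul_le_mul_of_nonneg_left hD hε
  have e : gridInner L M (e' - e) (e' - e) / τ
      = 2 * (1 / (2 * τ) * gridInner L M (e' - e) (e' - e)) := by field_simp
  rw [e]
  linarith

/-- Discrete maximum principle. -/
theorem le_of_sub_gridLaplacian_le {a b m : ℝ} (ha : 0 < a) (hb : 0 ≤ b) {V : Grid M}
    (h : ∀ i j, a * V i j - b * gridLaplacian L M V i j ≤ a * m) : ∀ i j, V i j ≤ m := by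
  obtain ⟨⟨p, q⟩, hmax⟩ := Finite.exists_max (fun x : ZMod M × ZMod M => V x.1 x.2)
  have hΔ : gridLaplacian L M V p q ≤ 0 := by
    rw [gridLaplacian]
    refine mul_nonpos_of_nonneg_of_nonpos (by positivity) ?_
    have h1 := hmax (p + 1, q)
    have h2 := hmax (p - 1, q)
    have h3 := hmax (p, q + 1)
    have h4 := hmax (p, q - 1)
    simp only at h1 h2 h3 h4
    linarith
  have hpq : V p q ≤ m := by
    have := h p q
    have := mul_nonpos_of_nonneg_of_nonpos hb hΔ
    exact le_of_mul_le_mul_left (by linarith) ha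
  exact fun i j => (hmax (i, j)).trans hpq

end Grid

/-! ### Consequences of the bounds on the nonlinearity -/

section Nonlinearity

variable {β κ K : ℝ} {f F : ℝ → ℝ}

theorem abs_sub_le_of_deriv_bound (hf : ∀ ξ ∈ Set.Icc (-β) β, ContDiffAt ℝ 1 f ξ)
    (hK : ∀ ξ ∈ Set.Icc (-β) β, |deriv f ξ| ≤ K) {a b : ℝ} (ha : a ∈ Set.Icc (-β) β)
    (hb : b ∈ Set.Icc (-β) β) : |f b - f a| ≤ K * |b - a| :=
  (convex_Icc (-β) β).norm_image_sub_le_of_norm_deriv_le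
    (fun x hx => (hf x hx).differentiableAt one_ne_zero) hK ha hb

theorem abs_potential_sub_le (hF : ∀ ξ ∈ Set.Icc (-β) β, HasDerivAt F (-f ξ) ξ)
    (hK : ∀ ξ ∈ Set.Icc (-β) β, |f ξ| ≤ K) {a b : ℝ} (ha : a ∈ Set.Icc (-β) β)
    (hb : b ∈ Set.Icc (-β) β) : |F b - F a| ≤ K * |b - a| :=
  (convex_Icc (-β) β).norm_image_sub_le_of_norm_hasDerivWithin_le
    (fun x hx => (hF x hx).hasDerivWithinAt) (fun x hx => by simpa using hK x hx) ha hb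

/-- First-order Taylor estimate for the potential, with `F' = -f`. -/
theorem abs_potential_taylor_le (hf : ∀ ξ ∈ Set.Icc (-β) β, ContDiffAt ℝ 1 f ξ)
    (hF : ∀ ξ ∈ Set.Icc (-β) β, HasDerivAt F (-f ξ) ξ)
    (hK : ∀ ξ ∈ Set.Icc (-β) β, |deriv f ξ| ≤ K) {a b : ℝ} (ha : a ∈ Set.Icc (-β) β)
    (hb : b ∈ Set.Icc (-β) β) : |F b - F a + f a * (b - a)| ≤ K * (b - a) ^ 2 := by
  have hK0 : 0 ≤ K := (abs_nonneg _).trans (hK a ha)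
  have hsub : Set.uIcc a b ⊆ Set.Icc (-β) β := Set.ordConnected_Icc.uIcc_subset ha hb
  have := (convex_uIcc a b).norm_image_sub_le_of_norm_hasDerivWithin_le
    (f := fun x => F x + x * f a) (f' := fun x => f a - f x) (C := K * |b - a|)
    (fun x hx => (((hF x (hsub hx)).add
      ((hasDerivAt_id x).mul_const (f a))).congr_deriv (by ring)).hasDerivWithinAt)
    (fun x hx => by
      rw [Real.norm_eq_abs, abs_sub_comm]
      refine (abs_sub_le_of_deriv_bound hf hK ha (hsub hx)).trans
        (mul_le_mul_of_nonneg_left ?_ hK0)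
      exact Set.abs_sub_left_of_mem_uIcc hx)
    Set.left_mem_uIcc Set.right_mem_uIcc
  calc _ = |F b + b * f a - (F a + a * f a)| := by congr 1; ring
    _ ≤ K * |b - a| * |b - a| := this
    _ = _ := by rw [mul_assoc, ← sq, sq_abs]

/-- The stabilized nonlinearity `κ ξ + f ξ` is monotone, so it maps `[-β, β]` into
`[-κ β, κ β]`. -/
theorem abs_stabilized_le (hβ : 0 < β) (hf : ∀ ξ ∈ Set.Icc (-β) β, ContDiffAt ℝ 1 f ξ)
    (hκ : ∀ ξ ∈ Set.Icc (-β) β, |deriv f ξ| ≤ κ) (h₁ : f β ≤ 0) (h₂ : 0 ≤ f (-β)) {ξ : ℝ}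
    (hξ : ξ ∈ Set.Icc (-β) β) : |κ * ξ + f ξ| ≤ κ * β := by
  have hr := abs_le.1 (abs_sub_le_of_deriv_bound hf hκ hξ (b := β) ⟨by linarith, le_rfl⟩)
  have hl := abs_le.1 (abs_sub_le_of_deriv_bound hf hκ hξ (b := -β) ⟨le_rfl, by linarith⟩)
  rw [abs_of_nonneg (by linarith [hξ.2] : 0 ≤ β - ξ)] at hr
  rw [abs_of_nonpos (by linarith [hξ.1] : -β - ξ ≤ 0)] at hl
  exact abs_le.2 ⟨by linarith [hl.2], by linarith [hr.1]⟩

end Nonlinearity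

/-- The scheme preserves the maximum bound for every time step. -/
theorem IsSESAV1.abs_le {L : ℝ} {M : ℕ} [NeZero M] {ε κ τ β : ℝ} {f F : ℝ → ℝ}
    {uinit : Plane → ℝ} {U : ℕ → Grid M} {S : ℕ → ℝ}
    (h : IsSESAV1 L M ε κ τ f F uinit U S) (hτ : 0 < τ) (hβ : 0 < β)
    (hf : ∀ ξ ∈ Set.Icc (-β) β, ContDiffAt ℝ 1 f ξ)
    (hκ : ∀ ξ ∈ Set.Icc (-β) β, |deriv f ξ| ≤ κ) (h₁ : f β ≤ 0) (h₂ : 0 ≤ f (-β))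
    (hinit : ∀ x, |uinit x| ≤ β) (n : ℕ) : ∀ i j, U n i j ∈ Set.Icc (-β) β := by
  have hκ0 : 0 ≤ κ := (abs_nonneg _).trans (hκ β ⟨by linarith, le_rfl⟩)
  induction n with
  | zero =>
    intro i j
    rw [h.init_u]
    exact Set.mem_Icc.2 (_root_.abs_le.1 (hinit _))
  | succ n ih =>
    set g := coeff L M F (U n) (S n) with hg
    have hg0 : 0 < g := div_pos (Real.exp_pos _) (Real.exp_pos _)
    have ha : 0 < 1 / τ + κ * g := by positivity
    have hstep : ∀ i j, (1 / τ + κ * g) * U (n + 1) i j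
        - ε ^ 2 * gridLaplacian L M (U (n + 1)) i j
        = 1 / τ * U n i j + g * (κ * U n i j + f (U n i j)) := by
      intro i j
      have := h.step_u n i j
      rw [← hg] at this
      rw [sub_div] at this
      field_simp at this ⊢
      linarith
    have hb := fun i j => _root_.abs_le.1 (abs_stabilized_le hβ hf hκ h₁ h₂ (ih i j))
    have hτ' : 0 < 1 / τ := by positivity
    intro i j
    refine ⟨neg_le.1 (le_of_sub_gridLaplacian_le (L := L) ha (sq_nonneg ε) (V := -U (n + 1))
      (fun i j => ?_) i j), le_of_sub_gridLaplacian_le (L := L) ha (sq_nonneg ε) (fun i j => ?_) i j⟩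
    · rw [gridLaplacian_neg, Pi.neg_apply, Pi.neg_apply]
      have e := hstep i j
      have := mul_le_mul_of_nonneg_left (hb i j).1 hg0.le
      have := mul_le_mul_of_nonneg_left (ih i j).1 hτ'.le
      linarith
    · rw [hstep i j]
      have := mul_le_mul_of_nonneg_left (hb i j).2 hg0.le
      have := mul_le_mul_of_nonneg_left (ih i j).2 hτ'.le
      linarith

/-! ### Derivatives along coordinate lines -/

/-- The `k`-th derivative of `s ↦ φ (x + s eᵢ)` at `s`, where `eᵢ` is a unit coordinate vector. -/
noncomputable def coordDeriv (φ : Plane → ℝ) (x : Plane) (i : Fin 2) (k : ℕ) (s : ℝ) : ℝ :=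
  iteratedFDeriv ℝ k φ (x + s • EuclideanSpace.single i (1 : ℝ))
    (fun _ => EuclideanSpace.single i (1 : ℝ))

theorem coordDeriv_zero (φ : Plane → ℝ) (x : Plane) (i : Fin 2) (s : ℝ) :
    coordDeriv φ x i 0 s = φ (x + s • EuclideanSpace.single i (1 : ℝ)) := by
  simp [coordDeriv]

theorem hasDerivAt_coordDeriv {φ : Plane → ℝ} {n k : ℕ} (hφ : ContDiff ℝ n φ) (hk : k < n)
    (x : Plane) (i : Fin 2) (s : ℝ) :
    HasDerivAt (coordDeriv φ x i k) (coordDeriv φ x i (k + 1) s) s := by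
  set v : Plane := EuclideanSpace.single i (1 : ℝ) with hv
  have hd := (hφ.differentiable_iteratedFDeriv (m := k) (by exact_mod_cast hk)
    (x + s • v)).hasFDerivAt
  have hl : HasDerivAt (fun r : ℝ => x + r • v) v s := by
    simpa using ((hasDerivAt_id s).smul_const v).const_add x
  have hc := hd.comp_hasDerivAt s hl
  have := ((ContinuousMultilinearMap.apply ℝ (fun _ : Fin k => Plane) ℝ
    (fun _ => v)).hasFDerivAt).comp_hasDerivAt s hc
  refine this.congr_deriv ?_
  rw [coordDeriv, iteratedFDeriv_succ_apply_left]
  rfl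

theorem abs_coordDeriv_le (φ : Plane → ℝ) (x : Plane) (i : Fin 2) (k : ℕ) (s : ℝ) :
    |coordDeriv φ x i k s|
      ≤ ‖iteratedFDeriv ℝ k φ (x + s • EuclideanSpace.single i (1 : ℝ))‖ := by
  have := (iteratedFDeriv ℝ k φ (x + s • EuclideanSpace.single i (1 : ℝ))).le_opNorm
    (fun _ => EuclideanSpace.single i (1 : ℝ))
  simpa [coordDeriv] using this

theorem laplacian_eq_sum_coordDeriv (φ : Plane → ℝ) (x : Plane) :
    Laplacian.laplacian φ x = coordDeriv φ x 0 2 0 + coordDeriv φ x 1 2 0 := by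
  rw [InnerProductSpace.laplacian_eq_iteratedFDeriv_orthonormalBasis φ
    (EuclideanSpace.basisFun (Fin 2) ℝ)]
  have : ∀ v : Plane, ![v, v] = fun _ => v := by
    intro v; ext j; fin_cases j <;> rfl
  simp [coordDeriv, this]

theorem add_smul_single_zero (a b s : ℝ) :
    (!₂[a, b] : Plane) + s • EuclideanSpace.single 0 (1 : ℝ) = !₂[a + s, b] := by
  ext j; fin_cases j <;> simp

theorem add_smul_single_one (a b s : ℝ) :
    (!₂[a, b] : Plane) + s • EuclideanSpace.single 1 (1 : ℝ) = !₂[a, b + s] := by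
  ext j; fin_cases j <;> simp

theorem norm_vec_le (a b : ℝ) : ‖(!₂[a, b] : Plane)‖ ≤ |a| + |b| := by
  rw [EuclideanSpace.norm_eq]
  refine Real.sqrt_le_iff.2 ⟨by positivity, ?_⟩
  simp only [Fin.sum_univ_two, Real.norm_eq_abs, Matrix.cons_val_zero, Matrix.cons_val_one,
    Matrix.cons_val_fin_one]
  nlinarith [abs_nonneg a, abs_nonneg b]

theorem laplacian_nonpos_of_isMax {φ : Plane → ℝ} (hφ : ContDiff ℝ 2 φ) {x : Plane}
    (hx : ∀ y, φ y ≤ φ x) : Laplacian.laplacian φ x ≤ 0 := by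
  have key : ∀ i, coordDeriv φ x i 2 0 ≤ 0 := by
    intro i
    by_contra! hpos
    have h₀ := hasDerivAt_coordDeriv (n := 2) (k := 0) hφ (by norm_num) x i
    have h₁ := hasDerivAt_coordDeriv (n := 2) (k := 1) hφ (by norm_num) x i
    have d₀ : deriv (coordDeriv φ x i 0) = coordDeriv φ x i 1 := funext fun s => (h₀ s).deriv
    have hmax : IsLocalMax (coordDeriv φ x i 0) 0 := Filter.Eventually.of_forall fun s => by
      simpa [coordDeriv_zero] using hx _
    have hmin : IsLocalMin (coordDeriv φ x i 0) 0 := by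
      refine isLocalMin_of_deriv_deriv_pos ?_ hmax.deriv_eq_zero (h₀ 0).continuousAt
      rw [d₀, (h₁ 0).deriv]; exact hpos
    have hconst : coordDeriv φ x i 0 =ᶠ[nhds 0] fun _ => coordDeriv φ x i 0 0 := by
      filter_upwards [hmax, hmin] with s h1 h2 using le_antisymm h1 h2
    have := hconst.deriv.deriv_eq
    rw [d₀, (h₁ 0).deriv] at this
    simp at this
    linarith
  rw [laplacian_eq_sum_coordDeriv]
  linarith [key 0, key 1]

/-! ### Periodicity and restriction to the mesh -/

theorem IsPeriodic.periodic_fst {L : ℝ} {φ : Plane → ℝ} (h : IsPeriodic L φ) (y : ℝ) :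
    Function.Periodic (fun x => φ !₂[x, y]) L := by
  intro x
  have := (h !₂[x, y]).1
  simp only
  rw [← this]; congr 1; ext j; fin_cases j <;> simp

theorem IsPeriodic.periodic_snd {L : ℝ} {φ : Plane → ℝ} (h : IsPeriodic L φ) (x : ℝ) :
    Function.Periodic (fun y => φ !₂[x, y]) L := by
  intro y
  have := (h !₂[x, y]).2
  simp only
  rw [← this]; congr 1; ext j; fin_cases j <;> simp

theorem IsPeriodic.exists_mem_box {L : ℝ} (hL : 0 < L) {φ : Plane → ℝ} (h : IsPeriodic L φ)
    (x : Plane) : ∃ y ∈ Metric.closedBall (0 : Plane) (4 * L), φ x = φ y := by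
  obtain ⟨a, ha, ea⟩ := (h.periodic_fst (x 1)).exists_mem_Ico₀ hL (x 0)
  obtain ⟨b, hb, eb⟩ := (h.periodic_snd a).exists_mem_Ico₀ hL (x 1)
  refine ⟨!₂[a, b], ?_, ?_⟩
  · rw [mem_closedBall_zero_iff]
    refine (norm_vec_le a b).trans ?_
    rw [abs_of_nonneg ha.1, abs_of_nonneg hb.1]
    linarith [ha.2, hb.2]
  · simp only at ea eb
    rw [← eb, ← ea]
    congr 1; ext j; fin_cases j <;> simp

section Mesh

variable {L : ℝ} {M : ℕ} [NeZero M] {χ : ℝ → ℝ}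

theorem periodic_natCast_val (hχ : Function.Periodic χ L) (n : ℕ) :
    χ (((n : ZMod M).val : ℝ) * meshSize L M) = χ (n * meshSize L M) := by
  have e : (n : ℝ) * meshSize L M
      = ((n % M : ℕ) : ℝ) * meshSize L M + ((n / M : ℕ) : ℝ) * L := by
    conv_lhs => rw [← Nat.mod_add_div n M]
    push_cast
    linear_combination (n / M : ℕ) * meshSize_mul L M
  rw [ZMod.val_natCast, e]
  exact ((hχ.nat_mul (n / M)) _).symm

theorem periodic_val_add_one (hχ : Function.Periodic χ L) (i : ZMod M) :
    χ (((i + 1).val : ℝ) * meshSize L M) = χ (i.val * meshSize L M + meshSize L M) := by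
  have e : i + 1 = ((i.val + 1 : ℕ) : ZMod M) := by simp
  rw [e, periodic_natCast_val hχ]
  congr 1; push_cast; ring

theorem periodic_val_sub_one (hχ : Function.Periodic χ L) (i : ZMod M) :
    χ (((i - 1).val : ℝ) * meshSize L M) = χ (i.val * meshSize L M - meshSize L M) := by
  have hM : 1 ≤ M := NeZero.one_le
  have e : i - 1 = ((i.val + (M - 1) : ℕ) : ZMod M) := by
    rw [Nat.cast_add, Nat.cast_sub hM]; simp [sub_eq_add_neg]
  rw [e, periodic_natCast_val hχ, ← hχ (i.val * meshSize L M - meshSize L M)]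
  congr 1
  rw [Nat.cast_add, Nat.cast_sub hM]
  have := meshSize_mul L M
  push_cast; linarith

theorem meshSize_le (hL : 0 < L) : meshSize L M ≤ L := by
  have : (1 : ℝ) ≤ M := by exact_mod_cast NeZero.one_le
  exact div_le_self hL.le this

theorem val_mul_meshSize_mem (hL : 0 < L) (i : ZMod M) :
    (i.val : ℝ) * meshSize L M ∈ Set.Icc 0 L := by
  have hh := meshSize_pos (M := M) hL
  refine ⟨by positivity, ?_⟩
  have : (i.val : ℝ) ≤ M := by exact_mod_cast (ZMod.val_lt i).le
  calc _ ≤ (M : ℝ) * meshSize L M := mul_le_mul_of_nonneg_right this hh.le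
    _ = L := meshSize_mul L M

theorem mem_closedBall_of_mem_Icc {a b : ℝ} (ha : a ∈ Set.Icc 0 L) (hb : b ∈ Set.Icc 0 L)
    {s : ℝ} (hs : |s| ≤ L) (i : Fin 2) :
    (!₂[a, b] : Plane) + s • EuclideanSpace.single i (1 : ℝ)
      ∈ Metric.closedBall (0 : Plane) (4 * L) := by
  have hL : 0 ≤ L := ha.1.trans ha.2
  rw [mem_closedBall_zero_iff]
  have h1 := norm_vec_le a b
  rw [abs_of_nonneg ha.1, abs_of_nonneg hb.1] at h1
  have h2 : ‖s • (EuclideanSpace.single i (1 : ℝ) : Plane)‖ ≤ L := by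
    rw [norm_smul]; simpa using hs
  have := norm_add_le (!₂[a, b] : Plane) (s • EuclideanSpace.single i (1 : ℝ))
  linarith [ha.2, hb.2]

/-- The five-point Laplacian is second-order consistent at every mesh point. -/
theorem abs_gridLaplacian_restrict_sub_le (hL : 0 < L) {φ : Plane → ℝ} (hφ : ContDiff ℝ 4 φ)
    (hper : IsPeriodic L φ) {B : ℝ}
    (hB : ∀ x ∈ Metric.closedBall (0 : Plane) (4 * L), ‖iteratedFDeriv ℝ 4 φ x‖ ≤ B)
    (i j : ZMod M) :
    |gridLaplacian L M (restrict L M φ) i j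
        - Laplacian.laplacian φ !₂[(i.val : ℝ) * meshSize L M, (j.val : ℝ) * meshSize L M]|
      ≤ 4 * B * meshSize L M ^ 2 := by
  set h := meshSize L M with hh
  have hpos : 0 < h := meshSize_pos hL
  have hle : h ≤ L := meshSize_le hL
  set a := (i.val : ℝ) * h with ha
  set b := (j.val : ℝ) * h with hb
  have hdiff : ∀ m : Fin 2, |coordDeriv φ !₂[a, b] m 0 h + coordDeriv φ !₂[a, b] m 0 (-h)
      - 2 * coordDeriv φ !₂[a, b] m 0 0 - h ^ 2 * coordDeriv φ !₂[a, b] m 2 0| ≤ 2 * B * h ^ 4 := by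
    intro m
    have hd := fun k (hk : k < 4) s => hasDerivAt_coordDeriv (n := 4) hφ hk !₂[a, b] m s
    refine abs_second_difference_sub_le hpos.le (fun s _ => hd 0 (by norm_num) s)
      (fun s _ => hd 1 (by norm_num) s) (fun s _ => hd 2 (by norm_num) s)
      (fun s _ => hd 3 (by norm_num) s) (fun s hs => ?_)
    refine (abs_coordDeriv_le φ _ m 4 s).trans (hB _ ?_)
    exact mem_closedBall_of_mem_Icc (val_mul_meshSize_mem hL i) (val_mul_meshSize_mem hL j)
      ((abs_le.2 hs).trans hle) m
  have h0 := hdiff 0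
  have h1 := hdiff 1
  simp only [coordDeriv_zero, add_smul_single_zero, add_smul_single_one, add_zero] at h0 h1
  have r : ∀ p q : ZMod M, restrict L M φ p q = φ !₂[(p.val : ℝ) * h, (q.val : ℝ) * h] :=
    fun _ _ => rfl
  have r1 : restrict L M φ (i + 1) j = φ !₂[a + h, b] :=
    periodic_val_add_one (hper.periodic_fst b) i
  have r2 : restrict L M φ (i - 1) j = φ !₂[a - h, b] :=
    periodic_val_sub_one (hper.periodic_fst b) i
  have r3 : restrict L M φ i (j + 1) = φ !₂[a, b + h] :=
    periodic_val_add_one (hper.periodic_snd a) j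
  have r4 : restrict L M φ i (j - 1) = φ !₂[a, b - h] :=
    periodic_val_sub_one (hper.periodic_snd a) j
  rw [gridLaplacian, r1, r2, r3, r4, r i j, ← hh, ← ha, ← hb, laplacian_eq_sum_coordDeriv]
  rw [← sub_eq_add_neg] at h0 h1
  set d0 := coordDeriv φ !₂[a, b] 0 2 0
  set d1 := coordDeriv φ !₂[a, b] 1 2 0
  have e : 1 / h ^ 2 * (φ !₂[a + h, b] + φ !₂[a - h, b] + φ !₂[a, b + h] + φ !₂[a, b - h]
      - 4 * φ !₂[a, b]) - (d0 + d1)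
      = 1 / h ^ 2 * ((φ !₂[a + h, b] + φ !₂[a - h, b] - 2 * φ !₂[a, b] - h ^ 2 * d0)
        + (φ !₂[a, b + h] + φ !₂[a, b - h] - 2 * φ !₂[a, b] - h ^ 2 * d1)) := by
    field_simp; ring
  rw [e, abs_mul, abs_of_nonneg (by positivity)]
  calc _ ≤ 1 / h ^ 2 * (2 * B * h ^ 4 + 2 * B * h ^ 4) :=
        mul_le_mul_of_nonneg_left ((abs_add_le _ _).trans (add_le_add h0 h1)) (by positivity)
    _ = _ := by field_simp; ring

theorem sum_zmod_val (g : ℕ → ℝ) : ∑ i : ZMod M, g i.val = ∑ i ∈ Finset.range M, g i := by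
  cases M with
  | zero => exact absurd rfl (NeZero.ne 0)
  | succ m => exact Fin.sum_univ_eq_sum_range g (m + 1)

end Mesh

/-! ### The continuous maximum bound -/

theorem nonneg_of_hasDerivWithinAt_of_le {w : ℝ → ℝ} {d T t : ℝ} (ht : 0 < t) (htT : t ≤ T)
    (hw : HasDerivWithinAt w d (Set.Icc 0 T) t) (hle : ∀ s ∈ Set.Ico 0 t, w s ≤ w t) : 0 ≤ d := by
  have hw' : HasDerivWithinAt w d (Set.Ico 0 t) t :=
    hw.mono (Set.Ico_subset_Icc_self.trans (Set.Icc_subset_Icc_right htT))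
  rw [hasDerivWithinAt_iff_tendsto_slope' (by simp)] at hw'
  have : (nhdsWithin t (Set.Ico 0 t)).NeBot := by
    rw [nhdsWithin_Ico_eq_nhdsLT ht]; infer_instance
  refine ge_of_tendsto hw' ?_
  filter_upwards [self_mem_nhdsWithin] with s hs
  rw [slope_def_field]
  exact div_nonneg_of_nonpos (by linarith [hle s hs]) (by linarith [hs.2])

/-- Upper half of the maximum principle for `v_t = ε² Δv + r(v)`: `m` is a barrier as soon as
`r ξ ≤ k (ξ - m)` just above `m`. The comparison function is `m + η e^{(k+1)t}` with `η` small, and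
the contradiction arises at the first time it is touched. -/
theorem le_of_parabolic {L T ε m k δ : ℝ} (hL : 0 < L) {v : ℝ → Plane → ℝ} {r : ℝ → ℝ}
    (hcont : ContinuousOn (fun p : ℝ × Plane => v p.1 p.2) (Set.Icc 0 T ×ˢ Set.univ))
    (hC2 : ∀ t ∈ Set.Icc 0 T, ContDiff ℝ 2 (v t))
    (hper : ∀ t ∈ Set.Icc 0 T, IsPeriodic L (v t))
    (heq : ∀ t ∈ Set.Ioc 0 T, ∀ x, HasDerivWithinAt (fun s => v s x)
      (ε ^ 2 * Laplacian.laplacian (v t) x + r (v t x)) (Set.Icc 0 T) t)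
    (hinit : ∀ x, v 0 x ≤ m) (hδ : 0 < δ) (hr : ∀ ξ ∈ Set.Icc m (m + δ), r ξ ≤ k * (ξ - m)) :
    ∀ t ∈ Set.Icc 0 T, ∀ x, v t x ≤ m := by
  set W : ℝ → Plane → ℝ := fun t x => (v t x - m) * Real.exp (-((k + 1) * t)) with hW
  -- it suffices to bound `W` by every small positive `η`
  suffices key : ∀ η > 0, (∀ t ∈ Set.Icc 0 T, η * Real.exp ((k + 1) * t) ≤ δ) →
      ∀ t ∈ Set.Icc 0 T, ∀ x, W t x < η by
    intro t ht x
    by_contra! hlt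
    have hWpos : 0 < W t x := mul_pos (sub_pos.2 hlt) (Real.exp_pos _)
    obtain ⟨c, hc⟩ := (isCompact_Icc (a := (0 : ℝ)) (b := T)).exists_bound_of_continuousOn
      (f := fun t => Real.exp ((k + 1) * t)) (by fun_prop)
    have hc' : ∀ t ∈ Set.Icc 0 T, Real.exp ((k + 1) * t) ≤ c := fun s hs =>
      (le_abs_self _).trans (hc s hs)
    have hcpos : 0 < c := (Real.exp_pos _).trans_le (hc' t ht)
    have hη : 0 < min (W t x) (δ / c) := lt_min hWpos (by positivity)
    have := key _ hη (fun s hs => by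
      calc _ ≤ δ / c * c := mul_le_mul (min_le_right _ _) (hc' s hs) (Real.exp_pos _).le
            (by positivity)
        _ = δ := by field_simp) t ht x
    exact absurd this (not_lt.2 (min_le_left _ _))
  intro η hη hsmall
  by_contra! hcon
  obtain ⟨t₁, ht₁, x₁, hx₁⟩ := hcon
  have hWc : ContinuousOn (fun p : ℝ × Plane => W p.1 p.2) (Set.Icc 0 T ×ˢ Set.univ) := by
    refine (hcont.sub continuousOn_const).mul ?_
    fun_prop
  have hbox : ∀ t ∈ Set.Icc 0 T, ∀ x, ∃ y ∈ Metric.closedBall (0 : Plane) (4 * L),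
      W t x = W t y := by
    intro t ht x
    obtain ⟨y, hy, e⟩ := (hper t ht).exists_mem_box hL x
    exact ⟨y, hy, by simp only [hW, e]⟩
  set Q := Set.Icc (0 : ℝ) T ×ˢ Metric.closedBall (0 : Plane) (4 * L)
  have hQ : IsCompact Q := isCompact_Icc.prod (isCompact_closedBall _ _)
  have hWQ : ContinuousOn (fun p : ℝ × Plane => W p.1 p.2) Q :=
    hWc.mono (Set.prod_mono_right (Set.subset_univ _))
  have hA : IsCompact (Q ∩ (fun p : ℝ × Plane => W p.1 p.2) ⁻¹' Set.Ici η) :=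
    hQ.of_isClosed_subset (hWQ.preimage_isClosed_of_isClosed hQ.isClosed isClosed_Ici)
      Set.inter_subset_left
  obtain ⟨y₁, hy₁, e₁⟩ := hbox t₁ ht₁ x₁
  -- the first touching time
  obtain ⟨⟨t₀, x₀⟩, ⟨⟨ht₀, -⟩, hge⟩, hmin⟩ := hA.exists_isMinOn
    ⟨(t₁, y₁), ⟨ht₁, hy₁⟩, show η ≤ W t₁ y₁ from e₁ ▸ hx₁⟩ continuous_fst.continuousOn
  replace hge : η ≤ W t₀ x₀ := hge
  replace ht₀ : t₀ ∈ Set.Icc 0 T := ht₀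
  have hbefore : ∀ t ∈ Set.Ico 0 t₀, ∀ x, W t x < η := by
    intro t ht x
    have htT : t ∈ Set.Icc 0 T := ⟨ht.1, ht.2.le.trans ht₀.2⟩
    obtain ⟨y, hy, e⟩ := hbox t htT x
    by_contra! hlt
    have : t₀ ≤ t := hmin (a := (t, y)) ⟨⟨htT, hy⟩, show η ≤ W t y from e ▸ hlt⟩
    exact absurd ht.2 (not_lt.2 this)
  have hpos : 0 < t₀ := by
    rcases ht₀.1.eq_or_lt with h0 | h0
    · rw [← h0] at hge
      simp only [hW, mul_zero, neg_zero, Real.exp_zero, mul_one] at hge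
      linarith [hinit x₀]
    · exact h0
  have hat : ∀ x, W t₀ x ≤ η := by
    intro x
    have hc : ContinuousWithinAt (fun t => W t x) (Set.Ico 0 t₀) t₀ :=
      (hWc.comp (f := fun t => (t, x)) (s := Set.Icc 0 T) (by fun_prop)
        (fun t ht => ⟨ht, trivial⟩) t₀ ht₀).mono
        (Set.Ico_subset_Icc_self.trans (Set.Icc_subset_Icc_right ht₀.2))
    have : (nhdsWithin t₀ (Set.Ico 0 t₀)).NeBot := by
      rw [nhdsWithin_Ico_eq_nhdsLT hpos]; infer_instance
    refine le_of_tendsto hc ?_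
    filter_upwards [self_mem_nhdsWithin] with s hs using (hbefore s hs x).le
  have hWeq : W t₀ x₀ = η := le_antisymm (hat x₀) hge
  have hE : 0 < Real.exp (-((k + 1) * t₀)) := Real.exp_pos _
  have hv : v t₀ x₀ - m = η * Real.exp ((k + 1) * t₀) := by
    rw [← hWeq]
    simp only [hW]
    rw [mul_assoc, ← Real.exp_add]; simp
  have hΔ : Laplacian.laplacian (v t₀) x₀ ≤ 0 := by
    refine laplacian_nonpos_of_isMax (hC2 t₀ ht₀) fun y => ?_
    have := (hat y).trans_eq hWeq.symm
    simp only [hW] at this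
    linarith [le_of_mul_le_mul_right this hE]
  have hrv := hr (v t₀ x₀) ⟨by linarith [mul_pos hη (Real.exp_pos ((k + 1) * t₀))],
    by linarith [hsmall t₀ ht₀]⟩
  have hd : HasDerivWithinAt (fun s => W s x₀) ((ε ^ 2 * Laplacian.laplacian (v t₀) x₀
      + r (v t₀ x₀) - (k + 1) * (v t₀ x₀ - m)) * Real.exp (-((k + 1) * t₀))) (Set.Icc 0 T) t₀ := by
    have h1 := (heq t₀ ⟨hpos, ht₀.2⟩ x₀).sub_const m
    have h2 : HasDerivAt (fun s => Real.exp (-((k + 1) * s)))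
        (Real.exp (-((k + 1) * t₀)) * -((k + 1) * 1)) t₀ :=
      (((hasDerivAt_id t₀).const_mul (k + 1)).neg).exp
    exact (h1.mul h2.hasDerivWithinAt).congr_deriv (by ring)
  have hnn := nonneg_of_hasDerivWithinAt_of_le hpos ht₀.2 hd fun s hs =>
    ((hbefore s hs x₀).le).trans_eq hWeq.symm
  have : ε ^ 2 * Laplacian.laplacian (v t₀) x₀ ≤ 0 :=
    mul_nonpos_of_nonneg_of_nonpos (sq_nonneg ε) hΔ
  have hneg : ε ^ 2 * Laplacian.laplacian (v t₀) x₀ + r (v t₀ x₀) - (k + 1) * (v t₀ x₀ - m) < 0 := by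
    linarith [mul_pos hη (Real.exp_pos ((k + 1) * t₀))]
  linarith [mul_neg_of_neg_of_pos hneg hE]

/-- A function differentiable at `m` with `r m ≤ 0` lies below a line through `(m, 0)` just to the
right of `m`. -/
theorem exists_linear_bound_right {r : ℝ → ℝ} {m : ℝ} (hr : DifferentiableAt ℝ r m)
    (hm : r m ≤ 0) : ∃ k, ∃ δ > 0, ∀ ξ ∈ Set.Icc m (m + δ), r ξ ≤ k * (ξ - m) := by
  obtain ⟨c, hc⟩ := hr.isBigO_sub.bound
  obtain ⟨δ, hδ, hball⟩ := Metric.eventually_nhds_iff.1 hc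
  refine ⟨c, δ / 2, by positivity, fun ξ hξ => ?_⟩
  have := hball (y := ξ) (by
    rw [Real.dist_eq, abs_of_nonneg (by linarith [hξ.1])]; linarith [hξ.2])
  rw [Real.norm_eq_abs, Real.norm_eq_abs, abs_of_nonneg (by linarith [hξ.1] : 0 ≤ ξ - m)] at this
  linarith [le_abs_self (r ξ - r m)]

theorem IsSmoothEnough.continuousOn {T : ℝ} {u : ℝ → Plane → ℝ} (hu : IsSmoothEnough T u) :
    ContinuousOn (fun p : ℝ × Plane => u p.1 p.2) (Set.Icc 0 T ×ˢ Set.univ) := by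
  simpa using hu.time_continuous 0 (by norm_num)

/-- The exact solution inherits the bound `β` of its initial value. -/
theorem IsSolution.mem_Icc {L T ε β : ℝ} {f : ℝ → ℝ} {uinit : Plane → ℝ} {u : ℝ → Plane → ℝ}
    (h : IsSolution L T ε f uinit u) (hu : IsSmoothEnough T u) (hL : 0 < L) (hβ : 0 < β)
    (hf : ∀ ξ ∈ Set.Icc (-β) β, ContDiffAt ℝ 1 f ξ) (h₁ : f β ≤ 0) (h₂ : 0 ≤ f (-β))
    (hinit : ∀ x, |uinit x| ≤ β) :
    ∀ t ∈ Set.Icc 0 T, ∀ x, u t x ∈ Set.Icc (-β) β := by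
  have hd := fun ξ hξ => (hf ξ hξ).differentiableAt one_ne_zero
  have hC2 : ∀ t ∈ Set.Icc 0 T, ContDiff ℝ 2 (u t) := fun t ht =>
    (hu.space_contDiff t ht).of_le (by norm_num)
  have hc := hu.continuousOn
  obtain ⟨k, δ, hδ, hk⟩ := exists_linear_bound_right
    (hd β ⟨by linarith, le_rfl⟩) h₁
  have up := le_of_parabolic hL hc hC2 h.periodic h.equation
    (fun x => by rw [h.initial]; exact (abs_le.1 (hinit x)).2) hδ hk
  -- the lower bound is the upper bound for `-u`, which solves the equation with `-f (-ξ)`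
  obtain ⟨k', δ', hδ', hk'⟩ := exists_linear_bound_right (r := fun ξ => -f (-ξ)) (m := β)
    ((hd (-β) ⟨le_rfl, by linarith⟩).comp β differentiableAt_id.neg).neg (by linarith)
  have low := le_of_parabolic (v := fun t x => -u t x) (r := fun ξ => -f (-ξ)) (ε := ε) hL hc.neg
    (fun t ht => (hC2 t ht).neg)
    (fun t ht x => ⟨by simp only [(h.periodic t ht x).1], by simp only [(h.periodic t ht x).2]⟩)
    (fun t ht x => by
      refine (h.equation t ht x).neg.congr_deriv ?_
      have : Laplacian.laplacian (fun x => -u t x) = -Laplacian.laplacian (u t) :=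
        InnerProductSpace.laplacian_neg
      rw [this]
      simp only [Pi.neg_apply, neg_neg]; ring)
    (fun x => by rw [h.initial]; linarith [(abs_le.1 (hinit x)).1]) hδ' hk'
  exact fun t ht x => ⟨by linarith [low t ht x], up t ht x⟩

/-! ### Quadrature of the bulk energy -/

theorem integral_square_eq {L : ℝ} (hL : 0 < L) {ψ : Plane → ℝ} (hψ : Continuous ψ) :
    ∫ x in square L, ψ x = ∫ a in (0 : ℝ)..L, ∫ b in (0 : ℝ)..L, ψ !₂[a, b] := by
  set e : Plane ≃ᵐ ℝ × ℝ :=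
    (MeasurableEquiv.toLp 2 (Fin 2 → ℝ)).symm.trans MeasurableEquiv.finTwoArrow with he
  have hmp : MeasureTheory.MeasurePreserving e MeasureTheory.volume MeasureTheory.volume :=
    (MeasureTheory.volume_preserving_finTwoArrow ℝ).comp
      (EuclideanSpace.volume_preserving_symm_measurableEquiv_toLp (Fin 2))
  have hsq : square L = e ⁻¹' (Set.Ioo 0 L ×ˢ Set.Ioo 0 L) := by
    ext x
    simp only [square, Set.mem_ofPred_eq, Fin.forall_fin_two]
    rfl
  have hval : ∀ x : Plane, ψ x = (fun p : ℝ × ℝ => ψ !₂[p.1, p.2]) (e x) := by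
    intro x
    simp only
    congr 1
    ext j; fin_cases j <;> rfl
  have hcont : Continuous (fun p : ℝ × ℝ => ψ !₂[p.1, p.2]) := by fun_prop
  have hint : MeasureTheory.IntegrableOn (fun p : ℝ × ℝ => ψ !₂[p.1, p.2])
      (Set.Ioo 0 L ×ˢ Set.Ioo 0 L) (MeasureTheory.volume.prod MeasureTheory.volume) :=
    (hcont.continuousOn.integrableOn_compact (isCompact_Icc.prod isCompact_Icc)).mono_set
      (Set.prod_mono Set.Ioo_subset_Icc_self Set.Ioo_subset_Icc_self)
  rw [MeasureTheory.setIntegral_congr_fun (g := fun x => (fun p : ℝ × ℝ => ψ !₂[p.1, p.2]) (e x))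
      (hsq ▸ e.measurable (measurableSet_Ioo.prod measurableSet_Ioo)) (fun x _ => hval x), hsq,
    hmp.setIntegral_preimage_emb e.measurableEmbedding (fun p : ℝ × ℝ => ψ !₂[p.1, p.2]),
    MeasureTheory.Measure.volume_eq_prod, MeasureTheory.setIntegral_prod _ hint]
  simp only [intervalIntegral.integral_of_le hL.le, MeasureTheory.integral_Ioc_eq_integral_Ioo]

/-- The mesh sum of a periodic function whose second derivatives along the two coordinate
directions are bounded approximates its integral over the square to second order. -/
theorem abs_integral_square_sub_gridSum_le {L B : ℝ} (hL : 0 < L) {M : ℕ} [NeZero M]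
    {ψ : Plane → ℝ} (hψ : Continuous ψ) (hper : IsPeriodic L ψ) {D₁ D₂ : Plane → Fin 2 → ℝ → ℝ}
    (h₀ : ∀ x i s, HasDerivAt (fun s : ℝ => ψ (x + s • EuclideanSpace.single i (1 : ℝ)))
      (D₁ x i s) s)
    (h₁ : ∀ x i s, HasDerivAt (D₁ x i) (D₂ x i s) s)
    (hB : ∀ x i s, x + s • EuclideanSpace.single i (1 : ℝ) ∈ Metric.closedBall (0 : Plane) (4 * L) →
      |D₂ x i s| ≤ B) :
    |(∫ x in square L, ψ x) - gridSum L M (restrict L M ψ)|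
      ≤ 2 * L ^ 2 * B * meshSize L M ^ 2 := by
  have hMpos : 0 < M := NeZero.pos M
  set h := meshSize L M with hh
  have hpos : 0 < h := meshSize_pos hL
  have hMh : M * h = L := meshSize_mul L M
  have hcont : Continuous (fun p : ℝ × ℝ => ψ !₂[p.1, p.2]) := by fun_prop
  have hball : ∀ {a b : ℝ}, a ∈ Set.Icc 0 L → b ∈ Set.Icc 0 L →
      (!₂[a, b] : Plane) ∈ Metric.closedBall (0 : Plane) (4 * L) := by
    intro a b ha hb
    simpa using mem_closedBall_of_mem_Icc ha hb (s := 0) (by simpa using hL.le) 0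
  have vert : ∀ a ∈ Set.Icc 0 L, |(∫ b in (0 : ℝ)..L, ψ !₂[a, b])
      - h * ∑ j ∈ Finset.range M, ψ !₂[a, j * h]| ≤ B * L * h ^ 2 := by
    intro a ha
    refine abs_integral_sub_rectangle_le (φ := fun b => ψ !₂[a, b]) (φ' := D₁ !₂[a, 0] 1)
      (φ'' := D₂ !₂[a, 0] 1) hL (fun s _ => ?_) (fun s _ => h₁ _ _ s) (fun s hs => hB _ _ s ?_)
      ?_ M hMpos
    · simpa [add_smul_single_one] using h₀ !₂[a, 0] 1 s
    · rw [add_smul_single_one, zero_add]; exact hball ha hs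
    · simpa using ((hper.periodic_snd a) 0).symm
  have horiz : ∀ b ∈ Set.Icc 0 L, |(∫ a in (0 : ℝ)..L, ψ !₂[a, b])
      - h * ∑ i ∈ Finset.range M, ψ !₂[i * h, b]| ≤ B * L * h ^ 2 := by
    intro b hb
    refine abs_integral_sub_rectangle_le (φ := fun a => ψ !₂[a, b]) (φ' := D₁ !₂[0, b] 0)
      (φ'' := D₂ !₂[0, b] 0) hL (fun s _ => ?_) (fun s _ => h₁ _ _ s) (fun s hs => hB _ _ s ?_)
      ?_ M hMpos
    · simpa [add_smul_single_zero] using h₀ !₂[0, b] 0 s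
    · rw [add_smul_single_zero, zero_add]; exact hball hs hb
    · simpa using ((hper.periodic_fst b) 0).symm
  have hI : Continuous (fun a => ∫ b in (0 : ℝ)..L, ψ !₂[a, b]) :=
    intervalIntegral.continuous_parametric_intervalIntegral_of_continuous'
      (f := fun a b => ψ !₂[a, b]) hcont 0 L
  have hR : ∀ b, Continuous (fun a => ψ !₂[a, b]) := fun b => by fun_prop
  have hRs : Continuous (fun a => h * ∑ j ∈ Finset.range M, ψ !₂[a, j * h]) :=
    continuous_const.mul (continuous_finsetSum _ fun j _ => hR _)
  -- integrate the error of the rectangle rule in the second variable over the first one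
  have s₁ : |(∫ a in (0 : ℝ)..L, ∫ b in (0 : ℝ)..L, ψ !₂[a, b])
      - h * ∑ j ∈ Finset.range M, ∫ a in (0 : ℝ)..L, ψ !₂[a, j * h]| ≤ B * L * h ^ 2 * L := by
    have := intervalIntegral.norm_integral_le_of_norm_le_const (a := (0 : ℝ)) (b := L)
      (f := fun a => (∫ b in (0 : ℝ)..L, ψ !₂[a, b]) - h * ∑ j ∈ Finset.range M, ψ !₂[a, j * h])
      (C := B * L * h ^ 2) (fun a ha => vert a (by
        rw [Set.uIoc_of_le hL.le] at ha; exact Set.Ioc_subset_Icc_self ha))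
    rw [intervalIntegral.integral_sub (hI.intervalIntegrable _ _) (hRs.intervalIntegrable _ _),
      intervalIntegral.integral_const_mul, intervalIntegral.integral_finsetSum
        (fun j _ => (hR _).intervalIntegrable _ _), sub_zero, abs_of_pos hL] at this
    exact this
  have s₂ : |h * (∑ j ∈ Finset.range M, ∫ a in (0 : ℝ)..L, ψ !₂[a, j * h])
      - h * ∑ j ∈ Finset.range M, h * ∑ i ∈ Finset.range M, ψ !₂[i * h, j * h]|
      ≤ B * L * h ^ 2 * L := by
    rw [← mul_sub, ← Finset.sum_sub_distrib, abs_mul, abs_of_pos hpos]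
    calc _ ≤ h * ∑ j ∈ Finset.range M, B * L * h ^ 2 := by
          refine mul_le_mul_of_nonneg_left ((Finset.abs_sum_le_sum_abs _ _).trans
            (Finset.sum_le_sum fun j hj => horiz _ ⟨by positivity, ?_⟩)) hpos.le
          have : (j : ℝ) ≤ M := by exact_mod_cast (Finset.mem_range.1 hj).le
          rw [← hMh]
          exact mul_le_mul_of_nonneg_right this hpos.le
      _ = B * L * h ^ 2 * (M * h) := by
          rw [Finset.sum_const, Finset.card_range, nsmul_eq_mul]; ring
      _ = _ := by rw [hMh]
  have hg : gridSum L M (restrict L M ψ)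
      = h * ∑ j ∈ Finset.range M, h * ∑ i ∈ Finset.range M, ψ !₂[i * h, j * h] := by
    rw [gridSum, ← hh, Finset.sum_comm, ← Finset.mul_sum, ← mul_assoc, ← sq,
      ← sum_zmod_val (M := M) (fun j => ∑ i ∈ Finset.range M, ψ !₂[i * h, j * h])]
    congr 1
    refine Finset.sum_congr rfl fun j _ => ?_
    exact sum_zmod_val (M := M) (fun i => ψ !₂[(i : ℝ) * h, (j.val : ℝ) * h])
  rw [integral_square_eq hL hψ, hg]
  refine (abs_sub_le _ _ _).trans ((add_le_add s₁ s₂).trans_eq ?_)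
  ring

theorem abs_bulkEnergy_sub_gridBulkEnergy_le {L K B β : ℝ} (hL : 0 < L) (hB0 : 0 ≤ B) {M : ℕ}
    [NeZero M] {φ : Plane → ℝ} {f F : ℝ → ℝ} (hφ : ContDiff ℝ 4 φ) (hper : IsPeriodic L φ)
    (hβ : ∀ x, φ x ∈ Set.Icc (-β) β)
    (hB : ∀ x ∈ Metric.closedBall (0 : Plane) (4 * L), ∀ k ≤ 4, ‖iteratedFDeriv ℝ k φ x‖ ≤ B)
    (hf : ∀ ξ ∈ Set.Icc (-β) β, ContDiffAt ℝ 1 f ξ)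
    (hF : ∀ ξ ∈ Set.Icc (-β) β, HasDerivAt F (-f ξ) ξ)
    (hK : ∀ ξ ∈ Set.Icc (-β) β, |f ξ| ≤ K ∧ |deriv f ξ| ≤ K) :
    |bulkEnergy L F φ - gridBulkEnergy L M F (restrict L M φ)|
      ≤ 2 * L ^ 2 * (K * B ^ 2 + K * B) * meshSize L M ^ 2 := by
  rw [gridBulkEnergy_eq_gridSum]
  have hd := fun {k : ℕ} (hk : k < 4) => hasDerivAt_coordDeriv (n := 4) hφ hk
  refine abs_integral_square_sub_gridSum_le (ψ := fun x => F (φ x))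
    (D₁ := fun x i s => -f (coordDeriv φ x i 0 s) * coordDeriv φ x i 1 s)
    (D₂ := fun x i s => -(deriv f (coordDeriv φ x i 0 s) * coordDeriv φ x i 1 s)
        * coordDeriv φ x i 1 s + -f (coordDeriv φ x i 0 s) * coordDeriv φ x i 2 s)
    hL ?_ ?_ ?_ ?_ ?_
  · exact continuous_iff_continuousAt.2 fun x =>
      ContinuousAt.comp (f := φ) (g := F) (hF _ (hβ x)).continuousAt hφ.continuous.continuousAt
  · exact fun x => ⟨by simp only [(hper x).1], by simp only [(hper x).2]⟩
  · intro x i s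
    have h0 := hd (k := 0) (by norm_num) x i s
    have hm := hβ (x + s • EuclideanSpace.single i (1 : ℝ))
    rw [← coordDeriv_zero φ] at hm
    simpa only [Function.comp_def, coordDeriv_zero] using (hF _ hm).comp s h0
  · intro x i s
    have h0 := hd (k := 0) (by norm_num) x i s
    have h1 := hd (k := 1) (by norm_num) x i s
    have hm := hβ (x + s • EuclideanSpace.single i (1 : ℝ))
    rw [← coordDeriv_zero φ] at hm
    exact (((hf _ hm).differentiableAt one_ne_zero).hasDerivAt.comp s h0).neg.mul h1
  · intro x i s hx
    have hm := hβ (x + s • EuclideanSpace.single i (1 : ℝ))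
    rw [← coordDeriv_zero φ] at hm
    obtain ⟨k0, k1⟩ := hK _ hm
    have b1 := (abs_coordDeriv_le φ x i 1 s).trans (hB _ hx 1 (by norm_num))
    have b2 := (abs_coordDeriv_le φ x i 2 s).trans (hB _ hx 2 (by norm_num))
    have hK0 : 0 ≤ K := (abs_nonneg _).trans k0
    refine (abs_add_le _ _).trans (add_le_add ?_ ?_)
    · rw [abs_mul, abs_neg, abs_mul, mul_assoc, sq]
      gcongr
    · rw [abs_mul, abs_neg]
      gcongr

/-! ### Consistency of the scheme -/

/-- `B` bounds the derivatives of `u` that enter the consistency error, on a ball containing a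
neighbourhood of the periodicity cell. -/
def IsDerivBound (L T B : ℝ) (u : ℝ → Plane → ℝ) : Prop :=
  ∀ t ∈ Set.Icc 0 T, ∀ x ∈ Metric.closedBall (0 : Plane) (4 * L),
    (∀ k ≤ 2, |iteratedDerivWithin k (fun s => u s x) (Set.Icc 0 T) t| ≤ B) ∧
      ∀ k ≤ 4, ‖iteratedFDeriv ℝ k (u t) x‖ ≤ B

theorem IsSmoothEnough.exists_isDerivBound {T : ℝ} {u : ℝ → Plane → ℝ} (hu : IsSmoothEnough T u)
    (L : ℝ) : ∃ B, 0 ≤ B ∧ IsDerivBound L T B u := by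
  have hQ : IsCompact (Set.Icc (0 : ℝ) T ×ˢ Metric.closedBall (0 : Plane) (4 * L)) :=
    isCompact_Icc.prod (isCompact_closedBall _ _)
  have hsub : Set.Icc (0 : ℝ) T ×ˢ Metric.closedBall (0 : Plane) (4 * L)
      ⊆ Set.Icc 0 T ×ˢ Set.univ := Set.prod_mono_right (Set.subset_univ _)
  choose! a ha using fun k (hk : k ≤ 2) =>
    hQ.exists_bound_of_continuousOn ((hu.time_continuous k hk).mono hsub)
  choose! b hb using fun k (hk : k ≤ 4) =>
    hQ.exists_bound_of_continuousOn ((hu.space_continuous k hk).mono hsub)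
  refine ⟨∑ k ∈ Finset.range 3, |a k| + ∑ k ∈ Finset.range 5, |b k|, by positivity,
    fun t ht x hx => ⟨fun k hk => ?_, fun k hk => ?_⟩⟩
  · have h1 := ha k hk (t, x) ⟨ht, hx⟩
    have h2 := Finset.single_le_sum (f := fun k => |a k|) (fun i _ => abs_nonneg _)
      (Finset.mem_range.2 (show k < 3 by omega))
    have h3 : 0 ≤ ∑ k ∈ Finset.range 5, |b k| := by positivity
    rw [Real.norm_eq_abs] at h1
    linarith [le_abs_self (a k)]
  · have h1 := hb k hk (t, x) ⟨ht, hx⟩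
    have h2 := Finset.single_le_sum (f := fun k => |b k|) (fun i _ => abs_nonneg _)
      (Finset.mem_range.2 (show k < 5 by omega))
    have h3 : 0 ≤ ∑ k ∈ Finset.range 3, |a k| := by positivity
    linarith [le_abs_self (b k)]

theorem IsSmoothEnough.hasDerivWithinAt {T : ℝ} (hT : 0 < T) {u : ℝ → Plane → ℝ}
    (hu : IsSmoothEnough T u) (x : Plane) {k : ℕ} (hk : k < 2) {t : ℝ} (ht : t ∈ Set.Icc 0 T) :
    HasDerivWithinAt (iteratedDerivWithin k (fun s => u s x) (Set.Icc 0 T))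
      (iteratedDerivWithin (k + 1) (fun s => u s x) (Set.Icc 0 T) t) (Set.Icc 0 T) t := by
  have := ((hu.time_contDiff x).differentiableOn_iteratedDerivWithin (m := k)
    (by exact_mod_cast hk) (uniqueDiffOn_Icc hT)) t ht
  rw [iteratedDerivWithin_succ]
  exact this.hasDerivWithinAt

section Consistency

variable {L T B : ℝ} {u : ℝ → Plane → ℝ} {M : ℕ} [NeZero M]

theorem mesh_mem_closedBall (hL : 0 < L) (i j : ZMod M) :
    (!₂[(i.val : ℝ) * meshSize L M, (j.val : ℝ) * meshSize L M] : Plane)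
      ∈ Metric.closedBall (0 : Plane) (4 * L) := by
  simpa using mem_closedBall_of_mem_Icc (val_mul_meshSize_mem hL i) (val_mul_meshSize_mem hL j)
    (s := 0) (by simpa using hL.le) 0

theorem abs_restrict_sub_le (hL : 0 < L) (hT : 0 < T) (hu : IsSmoothEnough T u)
    (hB : IsDerivBound L T B u) {t τ : ℝ} (ht : 0 ≤ t) (hτ : 0 < τ) (htT : t + τ ≤ T)
    (i j : ZMod M) :
    |restrict L M (u (t + τ)) i j - restrict L M (u t) i j| ≤ B * τ := by
  have hx := mesh_mem_closedBall (M := M) hL i j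
  have := (convex_Icc 0 T).norm_image_sub_le_of_norm_hasDerivWithin_le (x := t) (y := t + τ)
    (fun s hs => hu.hasDerivWithinAt hT _ (k := 0) (by norm_num) hs)
    (fun s hs => (hB s hs _ hx).1 1 (by norm_num)) ⟨ht, by linarith⟩ ⟨by linarith, htT⟩
  simp only [iteratedDerivWithin_zero, Real.norm_eq_abs, add_sub_cancel_left,
    abs_of_pos hτ] at this
  exact this

/-- Consistency: the restriction of the exact solution satisfies the unstabilized semi-implicit
Euler scheme up to `O(τ + h²)`. -/
theorem abs_consistency_error_le {ε K β : ℝ} {f : ℝ → ℝ} {uinit : Plane → ℝ} (hL : 0 < L)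
    (hT : 0 < T) (hu : IsSmoothEnough T u) (hB : IsDerivBound L T B u)
    (hsol : IsSolution L T ε f uinit u) (hβ : ∀ t ∈ Set.Icc 0 T, ∀ x, u t x ∈ Set.Icc (-β) β)
    (hf : ∀ ξ ∈ Set.Icc (-β) β, ContDiffAt ℝ 1 f ξ)
    (hK : ∀ ξ ∈ Set.Icc (-β) β, |deriv f ξ| ≤ K)
    {t τ : ℝ} (ht : 0 ≤ t) (hτ : 0 < τ) (htT : t + τ ≤ T) (i j : ZMod M) :
    |(restrict L M (u (t + τ)) i j - restrict L M (u t) i j) / τ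
        - ε ^ 2 * gridLaplacian L M (restrict L M (u (t + τ))) i j - f (restrict L M (u t) i j)|
      ≤ (B + K * B + 4 * ε ^ 2 * B) * (τ + meshSize L M ^ 2) := by
  have hx := mesh_mem_closedBall (M := M) hL i j
  have ht' : t + τ ∈ Set.Icc 0 T := ⟨by linarith, htT⟩
  have ht0 : t ∈ Set.Icc 0 T := ⟨ht, by linarith⟩
  set x : Plane := !₂[(i.val : ℝ) * meshSize L M, (j.val : ℝ) * meshSize L M] with hxdef
  have hr : ∀ s, restrict L M (u s) i j = u s x := fun _ => rfl
  have hB0 : 0 ≤ B := (abs_nonneg _).trans ((hB t ht0 x hx).1 0 (by norm_num))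
  have hK0 : 0 ≤ K := (abs_nonneg _).trans (hK _ (hβ t ht0 x))
  have htime := abs_backward_difference_sub_le
    (fun s hs => hu.hasDerivWithinAt hT x (k := 0) (by norm_num) hs)
    (fun s hs => hu.hasDerivWithinAt hT x (k := 1) (by norm_num) hs)
    (fun s hs => (hB s hs x hx).1 2 le_rfl) ht (by linarith : t ≤ t + τ) htT
  have heq : iteratedDerivWithin (0 + 1) (fun s => u s x) (Set.Icc 0 T) (t + τ)
      = ε ^ 2 * Laplacian.laplacian (u (t + τ)) x + f (u (t + τ) x) := by
    rw [zero_add, iteratedDerivWithin_one]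
    exact (hsol.equation (t + τ) ⟨by linarith, htT⟩ x).derivWithin (uniqueDiffOn_Icc hT _ ht')
  rw [heq, iteratedDerivWithin_zero, add_sub_cancel_left] at htime
  have hspace := abs_gridLaplacian_restrict_sub_le (M := M) hL (hu.space_contDiff _ ht')
    (hsol.periodic _ ht') (fun y hy => (hB _ ht' y hy).2 4 le_rfl) i j
  rw [← hxdef] at hspace
  have hlip := (abs_sub_le_of_deriv_bound hf hK (hβ t ht0 x) (hβ _ ht' x)).trans
    (mul_le_mul_of_nonneg_left (abs_restrict_sub_le (M := M) hL hT hu hB ht hτ htT i j) hK0)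
  simp only [hr]
  set Δh := gridLaplacian L M (restrict L M (u (t + τ))) i j
  set Δu := Laplacian.laplacian (u (t + τ)) x
  set h := meshSize L M
  have e : (u (t + τ) x - u t x) / τ - ε ^ 2 * Δh - f (u t x)
      = (u (t + τ) x - u t x - τ * (ε ^ 2 * Δu + f (u (t + τ) x))) / τ
        - ε ^ 2 * (Δh - Δu) + (f (u (t + τ) x) - f (u t x)) := by
    field_simp; ring
  have h1 : |(u (t + τ) x - u t x - τ * (ε ^ 2 * Δu + f (u (t + τ) x))) / τ| ≤ B * τ := by
    rw [abs_div, abs_of_pos hτ, div_le_iff₀ hτ]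
    linarith
  have h2 : |ε ^ 2 * (Δh - Δu)| ≤ ε ^ 2 * (4 * B * h ^ 2) := by
    rw [abs_mul, abs_of_nonneg (sq_nonneg ε)]
    exact mul_le_mul_of_nonneg_left hspace (sq_nonneg ε)
  rw [e]
  refine (abs_add_le _ _).trans ((add_le_add (abs_sub _ _) le_rfl).trans ?_)
  have p1 : 0 ≤ (B + K * B) * h ^ 2 := by positivity
  have p2 : 0 ≤ 4 * ε ^ 2 * B * τ := by positivity
  linarith

end Consistency

/-! ### The error recursion -/

/-- Scalar form of one step of the error analysis. Here `X`, `y`, `z` stand for `‖e‖²`,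
`ε²‖∇ₕe‖²` and the defect of the auxiliary variable before the step, primes mark the values after
it, and `d` is the norm of the increment of `e`. The term `d² / τ` gained from implicit Euler absorbs
all terms in `d`. -/
theorem energy_recursion {c₁ c₂ τ δ X X' y y' z z' d : ℝ} (hc₁ : 0 ≤ c₁) (hc₂ : 1 ≤ c₂)
    (hτ : 0 < τ) (hτδ : τ ≤ δ) (hδ : δ ≤ 2) (hX : 0 ≤ X) (hy : 0 ≤ y) (hy' : 0 ≤ y')
    (hd : 0 ≤ d) (hA : X + y + z ^ 2 ≤ 1) (hτ₁ : τ * (5 * c₁ + 1) ≤ 1)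
    (hτ₂ : τ * (64 * c₂ ^ 2) ≤ 1)
    (h₁ : d ^ 2 / τ + (y' - y) ≤ τ * (c₁ * (z ^ 2 + X + δ ^ 2)))
    (h₂ : X' ≤ X + 4 * τ * X + d ^ 2 / (4 * τ) + d ^ 2)
    (h₃ : |z' - z| ≤ c₂ * (|z| * (d + τ) + d ^ 2 + τ ^ 2)) :
    X' + y' + z' ^ 2
      ≤ X + y + z ^ 2 + τ * (c₁ + 4 + 15 * c₂ ^ 2) * (X + y + z ^ 2 + δ ^ 2) := by
  set a := |z| with ha
  have ha0 : 0 ≤ a := abs_nonneg z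
  have ha2 : z ^ 2 = a ^ 2 := (sq_abs z).symm
  have ha1 : a ≤ 1 := by nlinarith
  have hcc : c₂ ≤ c₂ ^ 2 := by nlinarith
  have hc1 : 1 ≤ c₂ ^ 2 := by nlinarith
  have hτ1 : τ ≤ 1 / 64 := by nlinarith
  have hδ2 : δ ^ 2 ≤ 4 := by nlinarith
  have hτδ2 : τ ^ 2 ≤ δ ^ 2 := by nlinarith
  obtain ⟨q, hq⟩ : ∃ q, q = d ^ 2 / τ := ⟨_, rfl⟩
  have hq0 : 0 ≤ q := by rw [hq]; positivity
  have hdq : d ^ 2 = τ * q := by rw [hq]; field_simp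
  have h4 : d ^ 2 / (4 * τ) = q / 4 := by rw [hq]; field_simp
  rw [← hq, ha2] at h₁
  rw [h4] at h₂
  rw [ha2] at hA ⊢
  -- the increment is at most one because `y ≤ 1`
  have hd1 : d ^ 2 ≤ 1 := by
    have e1 : c₁ * (a ^ 2 + X + δ ^ 2) ≤ c₁ * 5 :=
      mul_le_mul_of_nonneg_left (by linarith) hc₁
    have e2 : τ * (c₁ * (a ^ 2 + X + δ ^ 2)) ≤ τ * (c₁ * 5) := mul_le_mul_of_nonneg_left e1 hτ.le
    have e3 := mul_le_mul_of_nonneg_right (by linarith : τ ≤ 1) (by positivity : 0 ≤ c₁ * 5)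
    have hq5 : q ≤ c₁ * 5 + 1 := by linarith [sq_nonneg a]
    rw [hdq]
    calc τ * q ≤ τ * (c₁ * 5 + 1) := mul_le_mul_of_nonneg_left hq5 hτ.le
      _ ≤ 1 := by linarith
  have hcq : c₂ ^ 2 * d ^ 2 ≤ q / 64 := by
    have := mul_le_mul_of_nonneg_right hτ₂ hq0
    rw [hdq]; linarith
  have hcq' : c₂ * d ^ 2 ≤ q / 64 :=
    (mul_le_mul_of_nonneg_right hcc (sq_nonneg d)).trans hcq
  -- the cross term `z (z' - z)`
  have hcross : 2 * a * |z' - z| ≤ 5 / 32 * q + 11 * c₂ ^ 2 * τ * a ^ 2 + c₂ ^ 2 * τ * δ ^ 2 := by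
    have e0 : 2 * a * |z' - z| ≤ 2 * a * (c₂ * (a * (d + τ) + d ^ 2 + τ ^ 2)) :=
      mul_le_mul_of_nonneg_left h₃ (by linarith)
    have e1 : 2 * c₂ * a ^ 2 * d ≤ q / 8 + 8 * c₂ ^ 2 * τ * a ^ 2 := by
      have y1 : 16 * c₂ * τ * a * d ≤ τ * q + 64 * c₂ ^ 2 * τ ^ 2 * a ^ 2 := by
        rw [← hdq]; linarith [sq_nonneg (d - 8 * c₂ * τ * a)]
      have y2 : 2 * c₂ * a * d ≤ q / 8 + 8 * c₂ ^ 2 * τ * a ^ 2 := by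
        refine le_of_mul_le_mul_left ?_ hτ
        linarith
      have y3 := mul_le_mul_of_nonneg_left ha1 (by positivity : 0 ≤ 2 * c₂ * d * a)
      linarith
    have e2 : 2 * c₂ * a ^ 2 * τ ≤ 2 * c₂ ^ 2 * τ * a ^ 2 := by
      have := mul_le_mul_of_nonneg_right hcc (by positivity : 0 ≤ 2 * (a ^ 2 * τ))
      linarith
    have e3 : 2 * c₂ * a * d ^ 2 ≤ q / 32 := by
      have := mul_le_mul_of_nonneg_left ha1 (by positivity : 0 ≤ 2 * (c₂ * d ^ 2))
      linarith
    have e4 : 2 * c₂ * a * τ ^ 2 ≤ c₂ ^ 2 * τ * a ^ 2 + c₂ ^ 2 * τ * δ ^ 2 := by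
      have y1 : 2 * a * τ ≤ a ^ 2 + δ ^ 2 := by linarith [two_mul_le_add_sq a τ]
      have y2 : τ * (2 * a * τ) ≤ τ * (a ^ 2 + δ ^ 2) := mul_le_mul_of_nonneg_left y1 hτ.le
      have y3 := mul_le_mul hcc y2 (by positivity) (by positivity)
      linarith
    linarith
  have hsq : (z' - z) ^ 2 ≤ q / 8 + 4 * c₂ ^ 2 * τ * a ^ 2 + 4 * c₂ ^ 2 * τ * δ ^ 2 := by
    have e0 : (z' - z) ^ 2 ≤ (c₂ * (a * (d + τ) + d ^ 2 + τ ^ 2)) ^ 2 := by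
      rw [← sq_abs (z' - z)]
      exact pow_le_pow_left₀ (abs_nonneg _) h₃ 2
    have e1 : (a * (d + τ) + d ^ 2 + τ ^ 2) ^ 2
        ≤ 4 * ((a * d) ^ 2 + (a * τ) ^ 2 + (d ^ 2) ^ 2 + (τ ^ 2) ^ 2) := by
      linarith [sq_nonneg (a * d - a * τ), sq_nonneg (a * d - d ^ 2), sq_nonneg (a * d - τ ^ 2),
        sq_nonneg (a * τ - d ^ 2), sq_nonneg (a * τ - τ ^ 2), sq_nonneg (d ^ 2 - τ ^ 2)]
    have e2 : (a * d) ^ 2 ≤ d ^ 2 := by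
      rw [mul_pow]
      exact mul_le_of_le_one_left (sq_nonneg d) (pow_le_one₀ ha0 ha1)
    have e3 : (a * τ) ^ 2 ≤ τ * a ^ 2 := by
      have := mul_le_mul_of_nonneg_left (by linarith : τ ≤ 1) (mul_nonneg hτ.le (sq_nonneg a))
      linarith
    have e4 : (d ^ 2) ^ 2 ≤ d ^ 2 := by
      have := mul_le_mul_of_nonneg_left hd1 (sq_nonneg d)
      linarith
    have e5 : (τ ^ 2) ^ 2 ≤ τ * δ ^ 2 := by
      calc (τ ^ 2) ^ 2 = (τ * τ ^ 2) * τ := by ring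
        _ ≤ (τ * δ ^ 2) * 1 := by gcongr; linarith
        _ = _ := mul_one _
    calc (z' - z) ^ 2 ≤ c₂ ^ 2 * (a * (d + τ) + d ^ 2 + τ ^ 2) ^ 2 := by rw [← mul_pow]; exact e0
      _ ≤ c₂ ^ 2 * (4 * (d ^ 2 + τ * a ^ 2 + d ^ 2 + τ * δ ^ 2)) :=
        mul_le_mul_of_nonneg_left (by linarith) (sq_nonneg _)
      _ ≤ _ := by linarith
  -- the gain `q = d² / τ` pays for `5/32 + 1/8` from the defect and `1/4 + 1/64` from `X'`
  have hz : z' ^ 2 ≤ a ^ 2 + 2 * a * |z' - z| + (z' - z) ^ 2 := by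
    have e : z' ^ 2 = z ^ 2 + 2 * (z * (z' - z)) + (z' - z) ^ 2 := by ring
    have e' : z * (z' - z) ≤ a * |z' - z| := by rw [ha, ← abs_mul]; exact le_abs_self _
    rw [e, ha2]; linarith
  have hd4 : d ^ 2 ≤ q / 64 := by linarith [mul_le_mul_of_nonneg_right hτ1 hq0]
  have p1 : 0 ≤ τ * (c₁ + 4 + 15 * c₂ ^ 2) * y := by positivity
  have p2 : 0 ≤ τ * 15 * c₂ ^ 2 * X := by positivity
  have p3 : 0 ≤ τ * 4 * a ^ 2 := by positivity
  have p4 : 0 ≤ τ * (4 + 10 * c₂ ^ 2) * δ ^ 2 := by positivity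
  linarith

/-- Discrete Gronwall inequality in bootstrap form: the recursion is only available as long as the
quantity stays below one, which the conclusion guarantees. -/
theorem bootstrap_gronwall {A : ℕ → ℝ} {c τ T b : ℝ} (hc : 0 ≤ c) (hτ : 0 ≤ τ)
    (h0 : A 0 = 0) (hsmall : Real.exp (c * T) * b ≤ 1) (hb : 0 ≤ b)
    (hstep : ∀ n : ℕ, (n + 1) * τ ≤ T → A n ≤ 1 → A (n + 1) ≤ A n + τ * c * (A n + b)) :
    ∀ n : ℕ, n * τ ≤ T → A n ≤ Real.exp (c * T) * b := by
  suffices key : ∀ n : ℕ, n * τ ≤ T → A n + b ≤ Real.exp (c * (n * τ)) * b by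
    intro n hn
    have h1 := key n hn
    have h2 : Real.exp (c * (n * τ)) * b ≤ Real.exp (c * T) * b := by gcongr
    linarith
  intro n
  induction n with
  | zero => intro _; simp [h0]
  | succ n ih =>
    intro hn
    push_cast at hn ⊢
    have hn' : n * τ ≤ T := by linarith
    have h1 := ih hn'
    have h2 : Real.exp (c * (n * τ)) * b ≤ Real.exp (c * T) * b := by gcongr
    have h3 := hstep n hn (by linarith)
    have e : Real.exp (c * ((n + 1) * τ)) = Real.exp (τ * c) * Real.exp (c * (n * τ)) := by
      rw [← Real.exp_add]; congr 1; ring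
    calc A (n + 1) + b ≤ (τ * c + 1) * (A n + b) := by linarith
      _ ≤ Real.exp (τ * c) * (Real.exp (c * (n * τ)) * b) := by
        have := Real.add_one_le_exp (τ * c)
        have p : 0 ≤ Real.exp (c * (n * τ)) * b := by positivity
        calc _ ≤ (τ * c + 1) * (Real.exp (c * (n * τ)) * b) := by gcongr
          _ ≤ _ := by gcongr
      _ = _ := by rw [e, mul_assoc]

section Scheme

variable {L : ℝ} {M : ℕ} [NeZero M]

theorem gridInner_self_add_le {τ : ℝ} (hτ : 0 < τ) (e e' : Grid M) :
    gridInner L M e' e' ≤ gridInner L M e e + 4 * τ * gridInner L M e e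
      + gridInner L M (e' - e) (e' - e) / (4 * τ) + gridInner L M (e' - e) (e' - e) := by
  have : gridSum L M (fun i j => e' i j * e' i j)
      ≤ gridSum L M (fun i j => (1 + 4 * τ) * (e i j * e i j)
        + (1 / (4 * τ) + 1) * ((e' - e) i j * (e' - e) i j)) := by
    refine gridSum_mono fun i j => ?_
    simp only [Pi.sub_apply]
    set w := e' i j - e i j with hw
    have he : e' i j = e i j + w := by rw [hw]; ring
    have hy : 2 * (e i j * w) ≤ 4 * τ * (e i j * e i j) + 1 / (4 * τ) * (w * w) := by
      have h1 : 0 ≤ (4 * τ * e i j - w) ^ 2 / (4 * τ) := by positivity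
      have h2 : (4 * τ * e i j - w) ^ 2 / (4 * τ)
          = 4 * τ * (e i j * e i j) + 1 / (4 * τ) * (w * w) - 2 * (e i j * w) := by
        field_simp; ring
      linarith
    rw [he]; linarith
  rw [gridSum_add, gridSum_mul_left, gridSum_mul_left] at this
  simp only [← gridInner_eq_gridSum] at this
  refine this.trans_eq ?_
  field_simp; ring

theorem coeff_eq_exp (F : ℝ → ℝ) (v : Grid M) (s : ℝ) :
    coeff L M F v s = Real.exp (s - gridBulkEnergy L M F v) := by
  rw [coeff, Real.exp_sub]

/-- The defect `S - E₁ₕ(U)` of the auxiliary variable is conserved up to a term proportional to the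
defect itself and a term quadratic in the increment. -/
theorem IsSESAV1.abs_defect_sub_le {ε κ τ K β : ℝ} {f F : ℝ → ℝ} {uinit : Plane → ℝ}
    {U : ℕ → Grid M} {S : ℕ → ℝ} (h : IsSESAV1 L M ε κ τ f F uinit U S) (hτ : 0 < τ)
    (hf : ∀ ξ ∈ Set.Icc (-β) β, ContDiffAt ℝ 1 f ξ)
    (hF : ∀ ξ ∈ Set.Icc (-β) β, HasDerivAt F (-f ξ) ξ)
    (hK : ∀ ξ ∈ Set.Icc (-β) β, |f ξ| ≤ K ∧ |deriv f ξ| ≤ K)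
    (hU : ∀ n i j, U n i j ∈ Set.Icc (-β) β) (n : ℕ)
    (hz : |S n - gridBulkEnergy L M F (U n)| ≤ 1) :
    |(S (n + 1) - gridBulkEnergy L M F (U (n + 1))) - (S n - gridBulkEnergy L M F (U n))|
      ≤ 2 * |S n - gridBulkEnergy L M F (U n)| * K
          * gridSum L M (fun i j => |U (n + 1) i j - U n i j|)
        + K * gridSum L M (fun i j => (U (n + 1) i j - U n i j) ^ 2) := by
  have hS := h.step_s n
  rw [coeff_eq_exp] at hS
  set z := S n - gridBulkEnergy L M F (U n) with hzdef
  set g := Real.exp z with hg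
  have hg1 : |g - 1| ≤ 2 * |z| := Real.abs_exp_sub_one_le hz
  have hS' : S (n + 1) - S n
      = -g * gridSum L M (fun i j => f (U n i j) * (U (n + 1) i j - U n i j)) := by
    have e : gridInner L M (fun i j => f (U n i j)) (fun i j => (U (n + 1) i j - U n i j) / τ)
        = 1 / τ * gridSum L M (fun i j => f (U n i j) * (U (n + 1) i j - U n i j)) := by
      rw [gridInner_eq_gridSum, ← gridSum_mul_left]
      congr 1; ext i j; ring
    rw [e] at hS
    field_simp at hS
    linarith
  have e : (S (n + 1) - gridBulkEnergy L M F (U (n + 1))) - z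
      = gridSum L M (fun i j => (1 - g) * (f (U n i j) * (U (n + 1) i j - U n i j))
        - (F (U (n + 1) i j) - F (U n i j) + f (U n i j) * (U (n + 1) i j - U n i j))) := by
    rw [gridSum_sub, gridSum_mul_left, gridSum_add, gridSum_sub, hzdef, gridBulkEnergy_eq_gridSum,
      gridBulkEnergy_eq_gridSum]
    linarith
  rw [e, ← gridSum_mul_left, ← gridSum_mul_left, ← gridSum_add]
  refine (abs_gridSum_le _).trans (gridSum_mono fun i j => ?_)
  refine (abs_sub _ _).trans (add_le_add ?_
    (abs_potential_taylor_le hf hF (fun ξ hξ => (hK ξ hξ).2) (hU n i j) (hU (n + 1) i j)))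
  rw [abs_mul, abs_mul, abs_sub_comm 1 g, ← mul_assoc]
  have := (hK _ (hU n i j)).1
  gcongr

end Scheme

/-! ### Error estimate -/

/-- The quantity `‖e‖² + ε²‖∇ₕe‖² + z²` propagated by the error analysis. -/
noncomputable def errorEnergy (L : ℝ) (M : ℕ) [NeZero M] (ε : ℝ) (e : Grid M) (z : ℝ) : ℝ :=
  gridInner L M e e + ε ^ 2 * gradSq L M e + z ^ 2

/-- Constant of the `L²` bound for the source term in the error equation. -/
noncomputable def sourceConst (L ε κ K B : ℝ) : ℝ :=
  12 * K ^ 2 * L ^ 2 + 3 * K ^ 2 + 3 * (3 * κ * B + (B + K * B + 4 * ε ^ 2 * B)) ^ 2 * L ^ 2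

/-- Constant of the bound for the growth of the defect `S - E₁ₕ(U)`. -/
noncomputable def defectConst (L K B : ℝ) : ℝ :=
  1 + 2 * K * (L + L ^ 2 * B + 1 + L ^ 2 * B ^ 2)

theorem sourceConst_nonneg (L ε κ K B : ℝ) : 0 ≤ sourceConst L ε κ K B := by
  rw [sourceConst]; positivity

theorem one_le_defectConst {L K B : ℝ} (hL : 0 < L) (hK : 0 ≤ K) (hB : 0 ≤ B) :
    1 ≤ defectConst L K B := by
  have : 0 ≤ 2 * K * (L + L ^ 2 * B + 1 + L ^ 2 * B ^ 2) := by positivity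
  rw [defectConst]; linarith

section Scheme

variable {L T ε κ K B β τ : ℝ} {f F : ℝ → ℝ} {uinit : Plane → ℝ} {u : ℝ → Plane → ℝ}
  {M : ℕ} [NeZero M] {U : ℕ → Grid M} {S : ℕ → ℝ}

/-- `L²` bound for the source in the error equation, given a pointwise one. -/
theorem gridInner_source_le {a b c : ℝ} {G e : Grid M}
    (h : ∀ i j, |G i j| ≤ a + b * |e i j| + c) :
    gridInner L M G G ≤ 3 * a ^ 2 * L ^ 2 + 3 * b ^ 2 * gridInner L M e e + 3 * c ^ 2 * L ^ 2 := by
  have key : gridSum L M (fun i j => G i j * G i j)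
      ≤ gridSum L M (fun i j => (3 * b ^ 2 * (e i j * e i j)) + (3 * a ^ 2 + 3 * c ^ 2)) := by
    refine gridSum_mono fun i j => ?_
    have h1 : G i j * G i j ≤ (a + b * |e i j| + c) ^ 2 := by
      rw [← sq, ← sq_abs]
      exact pow_le_pow_left₀ (abs_nonneg _) (h i j) 2
    have h2 : |e i j| ^ 2 = e i j * e i j := by rw [sq_abs, sq]
    rw [← h2]
    linarith [sq_nonneg (a - b * |e i j|), sq_nonneg (a - c), sq_nonneg (b * |e i j| - c)]
  rw [gridSum_add, gridSum_mul_left, gridSum_const] at key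
  simp only [← gridInner_eq_gridSum] at key
  linarith

/-- The stabilized scheme for `U` minus the consistency relation for the restricted exact solution,
tested with the increment of the error. -/
theorem IsSESAV1.error_energy_le (h : IsSESAV1 L M ε κ τ f F uinit U S) (hL : 0 < L) (hT : 0 < T)
    (hτ : 0 < τ) (hκ0 : 0 ≤ κ) (hB0 : 0 ≤ B) (hu : IsSmoothEnough T u) (hB : IsDerivBound L T B u)
    (hsol : IsSolution L T ε f uinit u)
    (huβ : ∀ t ∈ Set.Icc 0 T, ∀ x, u t x ∈ Set.Icc (-β) β)
    (hf : ∀ ξ ∈ Set.Icc (-β) β, ContDiffAt ℝ 1 f ξ)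
    (hK : ∀ ξ ∈ Set.Icc (-β) β, |f ξ| ≤ K ∧ |deriv f ξ| ≤ K)
    (hU : ∀ n i j, U n i j ∈ Set.Icc (-β) β) (n : ℕ) (hn : n * τ + τ ≤ T)
    (hz : |S n - gridBulkEnergy L M F (U n)| ≤ 1) :
    gridInner L M ((U (n + 1) - restrict L M (u (n * τ + τ))) - (U n - restrict L M (u (n * τ))))
        ((U (n + 1) - restrict L M (u (n * τ + τ))) - (U n - restrict L M (u (n * τ)))) / τ
      + ε ^ 2 * (gradSq L M (U (n + 1) - restrict L M (u (n * τ + τ)))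
        - gradSq L M (U n - restrict L M (u (n * τ))))
      ≤ τ * (sourceConst L ε κ K B * ((S n - gridBulkEnergy L M F (U n)) ^ 2
        + gridInner L M (U n - restrict L M (u (n * τ))) (U n - restrict L M (u (n * τ)))
        + (τ + meshSize L M ^ 2) ^ 2)) := by
  have ht : (0 : ℝ) ≤ n * τ := by positivity
  have ht0 : (n : ℝ) * τ ∈ Set.Icc 0 T := ⟨ht, by linarith⟩
  set z := S n - gridBulkEnergy L M F (U n) with hzdef
  set R := restrict L M (u (n * τ)) with hR
  set R' := restrict L M (u (n * τ + τ)) with hR'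
  set g := Real.exp z with hg
  set δ := τ + meshSize L M ^ 2 with hδ
  have hδτ : τ ≤ δ := le_add_of_nonneg_right (sq_nonneg _)
  have hg0 : 0 < g := Real.exp_pos z
  have hg1 : |g - 1| ≤ 2 * |z| := Real.abs_exp_sub_one_le hz
  have hg3 : g ≤ 3 := by linarith [le_abs_self (g - 1)]
  set r : Grid M := fun i j => (R' i j - R i j) / τ - ε ^ 2 * gridLaplacian L M R' i j - f (R i j)
    with hr
  set G : Grid M := fun i j => (g - 1) * f (U n i j) + (f (U n i j) - f (R i j))
    - κ * g * (R' i j - R i j) - r i j with hG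
  have hstep : ∀ i j, ((U (n + 1) - R') i j - (U n - R) i j) / τ
      = ε ^ 2 * gridLaplacian L M (U (n + 1) - R') i j + G i j
        - κ * g * ((U (n + 1) - R') i j - (U n - R) i j) := by
    intro i j
    have hs := h.step_u n i j
    rw [coeff_eq_exp, ← hzdef, ← hg] at hs
    rw [gridLaplacian_sub]
    simp only [Pi.sub_apply, hG, hr]
    have e : (U (n + 1) i j - R' i j - (U n i j - R i j)) / τ
        = (U (n + 1) i j - U n i j) / τ - (R' i j - R i j) / τ := by ring
    rw [e, hs]
    ring
  have hGb : ∀ i j, |G i j| ≤ 2 * K * |z| + K * |(U n - R) i j|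
      + (3 * κ * B + (B + K * B + 4 * ε ^ 2 * B)) * δ := by
    intro i j
    have hRm : R i j ∈ Set.Icc (-β) β := huβ _ ht0 _
    have k1 := (hK _ (hU n i j)).1
    have hK0 : 0 ≤ K := (abs_nonneg _).trans k1
    have b1 : |(g - 1) * f (U n i j)| ≤ 2 * |z| * K := by
      rw [abs_mul]; gcongr
    have b2 := abs_sub_le_of_deriv_bound hf (fun ξ hξ => (hK ξ hξ).2) hRm (hU n i j)
    have b3 : |κ * g * (R' i j - R i j)| ≤ κ * 3 * (B * δ) := by
      rw [abs_mul, abs_of_nonneg (by positivity)]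
      have := (abs_restrict_sub_le (M := M) hL hT hu hB ht hτ hn i j).trans
        (mul_le_mul_of_nonneg_left hδτ hB0)
      gcongr
    have b4 : |r i j| ≤ (B + K * B + 4 * ε ^ 2 * B) * δ :=
      abs_consistency_error_le hL hT hu hB hsol huβ hf (fun ξ hξ => (hK ξ hξ).2) ht hτ hn i j
    calc |G i j| ≤ 2 * |z| * K + K * |U n i j - R i j| + κ * 3 * (B * δ)
          + (B + K * B + 4 * ε ^ 2 * B) * δ :=
        (abs_sub _ _).trans (add_le_add ((abs_sub _ _).trans (add_le_add
          ((abs_add_le _ _).trans (add_le_add b1 b2)) b3)) b4)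
      _ = _ := by simp only [Pi.sub_apply]; ring
  refine (heat_step_energy_le hτ (by positivity) hstep).trans
    (mul_le_mul_of_nonneg_left ((gridInner_source_le hGb).trans ?_) hτ.le)
  have hX := gridInner_self_nonneg (L := L) (U n - R)
  set X := gridInner L M (U n - R) (U n - R)
  set c := 3 * κ * B + (B + K * B + 4 * ε ^ 2 * B) with hc
  rw [mul_pow (2 * K), sq_abs, sourceConst, ← hc]
  have p1 : 0 ≤ (3 * K ^ 2 + 3 * c ^ 2 * L ^ 2) * z ^ 2 := by positivity
  have p2 : 0 ≤ (12 * K ^ 2 * L ^ 2 + 3 * c ^ 2 * L ^ 2) * X := by positivity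
  have p3 : 0 ≤ (12 * K ^ 2 * L ^ 2 + 3 * K ^ 2) * δ ^ 2 := by positivity
  linarith

/-- Growth of the defect in terms of the `L²` norm of the increment of the error. -/
theorem IsSESAV1.abs_defect_sub_le_of_error (h : IsSESAV1 L M ε κ τ f F uinit U S) (hL : 0 < L)
    (hT : 0 < T) (hτ : 0 < τ) (hB0 : 0 ≤ B) (hu : IsSmoothEnough T u)
    (hB : IsDerivBound L T B u) (hf : ∀ ξ ∈ Set.Icc (-β) β, ContDiffAt ℝ 1 f ξ)
    (hF : ∀ ξ ∈ Set.Icc (-β) β, HasDerivAt F (-f ξ) ξ)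
    (hK : ∀ ξ ∈ Set.Icc (-β) β, |f ξ| ≤ K ∧ |deriv f ξ| ≤ K)
    (hU : ∀ n i j, U n i j ∈ Set.Icc (-β) β) (n : ℕ) (hn : n * τ + τ ≤ T)
    (hz : |S n - gridBulkEnergy L M F (U n)| ≤ 1) {w : Grid M}
    (hw : w = (U (n + 1) - restrict L M (u (n * τ + τ))) - (U n - restrict L M (u (n * τ)))) :
    |(S (n + 1) - gridBulkEnergy L M F (U (n + 1))) - (S n - gridBulkEnergy L M F (U n))|
      ≤ defectConst L K B * (|S n - gridBulkEnergy L M F (U n)|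
          * (Real.sqrt (gridInner L M w w) + τ)
        + Real.sqrt (gridInner L M w w) ^ 2 + τ ^ 2) := by
  have ht : (0 : ℝ) ≤ n * τ := by positivity
  have hz0 := abs_nonneg (S n - gridBulkEnergy L M F (U n))
  have hK0 : 0 ≤ K := (abs_nonneg _).trans (hK _ (hU 0 0 0)).1
  refine (h.abs_defect_sub_le hτ hf hF hK hU n hz).trans ?_
  set a := |S n - gridBulkEnergy L M F (U n)|
  set d := Real.sqrt (gridInner L M w w) with hd
  have hd0 : 0 ≤ d := Real.sqrt_nonneg _
  have hd2 : d ^ 2 = gridInner L M w w := Real.sq_sqrt (gridInner_self_nonneg w)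
  have hδ : ∀ i j, |U (n + 1) i j - U n i j| ≤ |w i j| + B * τ := by
    intro i j
    have e : U (n + 1) i j - U n i j
        = w i j + (restrict L M (u (n * τ + τ)) i j - restrict L M (u (n * τ)) i j) := by
      rw [hw]; simp only [Pi.sub_apply]; ring
    rw [e]
    exact (abs_add_le _ _).trans (add_le_add le_rfl
      (abs_restrict_sub_le hL hT hu hB ht hτ hn i j))
  have h1 : gridSum L M (fun i j => |U (n + 1) i j - U n i j|) ≤ L * d + L ^ 2 * (B * τ) := by
    refine (gridSum_mono hδ).trans ?_
    rw [gridSum_add, gridSum_const]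
    exact add_le_add (gridSum_abs_le hL.le w) le_rfl
  have h2 : gridSum L M (fun i j => (U (n + 1) i j - U n i j) ^ 2)
      ≤ 2 * d ^ 2 + L ^ 2 * (2 * (B * τ) ^ 2) := by
    have : gridSum L M (fun i j => (U (n + 1) i j - U n i j) ^ 2)
        ≤ gridSum L M (fun i j => 2 * (w i j * w i j) + 2 * (B * τ) ^ 2) := by
      refine gridSum_mono fun i j => ?_
      rw [← sq_abs]
      have h3 := pow_le_pow_left₀ (abs_nonneg _) (hδ i j) 2
      have h4 : |w i j| ^ 2 = w i j * w i j := by rw [sq_abs, sq]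
      linarith [sq_nonneg (|w i j| - B * τ)]
    rw [gridSum_add, gridSum_mul_left, gridSum_const, ← gridInner_eq_gridSum, ← hd2] at this
    exact this
  calc _ ≤ 2 * a * K * (L * d + L ^ 2 * (B * τ)) + K * (2 * d ^ 2 + L ^ 2 * (2 * (B * τ) ^ 2)) := by
        gcongr
    _ ≤ _ := by
        rw [defectConst]
        have p1 : 0 ≤ (1 + 2 * K * (L ^ 2 * B + 1 + L ^ 2 * B ^ 2)) * (a * d) := by positivity
        have p2 : 0 ≤ (1 + 2 * K * (L + 1 + L ^ 2 * B ^ 2)) * (a * τ) := by positivity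
        have p3 : 0 ≤ (1 + 2 * K * (L + L ^ 2 * B + L ^ 2 * B ^ 2)) * d ^ 2 := by positivity
        have p4 : 0 ≤ (1 + 2 * K * (L + L ^ 2 * B + 1)) * τ ^ 2 := by positivity
        linarith

/-- The error energy grows by at most a factor `1 + O(τ)` and a source `O(τ (τ + h²)²)` per step, as
long as it is at most one. -/
theorem IsSESAV1.errorEnergy_succ_le (h : IsSESAV1 L M ε κ τ f F uinit U S) (hL : 0 < L)
    (hT : 0 < T) (hτ : 0 < τ) (hκ0 : 0 ≤ κ) (hB0 : 0 ≤ B) (hu : IsSmoothEnough T u)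
    (hB : IsDerivBound L T B u) (hsol : IsSolution L T ε f uinit u)
    (huβ : ∀ t ∈ Set.Icc 0 T, ∀ x, u t x ∈ Set.Icc (-β) β)
    (hf : ∀ ξ ∈ Set.Icc (-β) β, ContDiffAt ℝ 1 f ξ)
    (hF : ∀ ξ ∈ Set.Icc (-β) β, HasDerivAt F (-f ξ) ξ)
    (hK : ∀ ξ ∈ Set.Icc (-β) β, |f ξ| ≤ K ∧ |deriv f ξ| ≤ K)
    (hU : ∀ n i j, U n i j ∈ Set.Icc (-β) β)
    (hδ : τ + meshSize L M ^ 2 ≤ 2) (hτ₁ : τ * (5 * sourceConst L ε κ K B + 1) ≤ 1)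
    (hτ₂ : τ * (64 * defectConst L K B ^ 2) ≤ 1) (n : ℕ) (hn : n * τ + τ ≤ T)
    (hA : errorEnergy L M ε (U n - restrict L M (u (n * τ)))
      (S n - gridBulkEnergy L M F (U n)) ≤ 1) :
    errorEnergy L M ε (U (n + 1) - restrict L M (u (n * τ + τ)))
        (S (n + 1) - gridBulkEnergy L M F (U (n + 1)))
      ≤ errorEnergy L M ε (U n - restrict L M (u (n * τ))) (S n - gridBulkEnergy L M F (U n))
        + τ * (sourceConst L ε κ K B + 4 + 15 * defectConst L K B ^ 2)
          * (errorEnergy L M ε (U n - restrict L M (u (n * τ))) (S n - gridBulkEnergy L M F (U n))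
            + (τ + meshSize L M ^ 2) ^ 2) := by
  have hK0 : 0 ≤ K := (abs_nonneg _).trans (hK _ (hU 0 0 0)).1
  set e := U n - restrict L M (u (n * τ)) with he
  set e' := U (n + 1) - restrict L M (u (n * τ + τ)) with he'
  have hX := gridInner_self_nonneg (L := L) e
  have hY : 0 ≤ ε ^ 2 * gradSq L M e := mul_nonneg (sq_nonneg ε) (gradSq_nonneg e)
  have hY' : 0 ≤ ε ^ 2 * gradSq L M e' := mul_nonneg (sq_nonneg ε) (gradSq_nonneg e')
  have hz : |S n - gridBulkEnergy L M F (U n)| ≤ 1 := by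
    rw [errorEnergy] at hA
    exact (sq_le_one_iff_abs_le_one _).1 (by linarith)
  have hd2 : Real.sqrt (gridInner L M (e' - e) (e' - e)) ^ 2 = gridInner L M (e' - e) (e' - e) :=
    Real.sq_sqrt (gridInner_self_nonneg _)
  refine energy_recursion (d := Real.sqrt (gridInner L M (e' - e) (e' - e)))
    (sourceConst_nonneg L ε κ K B) (one_le_defectConst hL hK0 hB0) hτ
    (le_add_of_nonneg_right (sq_nonneg _)) hδ hX hY hY' (Real.sqrt_nonneg _) hA hτ₁ hτ₂ ?_ ?_ ?_
  · rw [hd2, ← mul_sub]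
    exact h.error_energy_le hL hT hτ hκ0 hB0 hu hB hsol huβ hf hK hU n hn hz
  · rw [hd2]
    exact gridInner_self_add_le hτ e e'
  · exact h.abs_defect_sub_le_of_error hL hT hτ hB0 hu hB hf hF hK hU n hn hz rfl

/-- From the error energy to the error: the energy error splits into the defect, the difference of
the discrete energies, and the quadrature error. -/
theorem error_le_of_errorEnergy_le {E δ t : ℝ} {V : Grid M} {s : ℝ} (hL : 0 < L) (hε : 0 < ε)
    (hB0 : 0 ≤ B) (hE : 1 ≤ E) (hδ : 0 ≤ δ) (ht : t ∈ Set.Icc 0 T) (hu : IsSmoothEnough T u)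
    (hB : IsDerivBound L T B u) (hsol : IsSolution L T ε f uinit u)
    (huβ : ∀ t ∈ Set.Icc 0 T, ∀ x, u t x ∈ Set.Icc (-β) β)
    (hf : ∀ ξ ∈ Set.Icc (-β) β, ContDiffAt ℝ 1 f ξ)
    (hF : ∀ ξ ∈ Set.Icc (-β) β, HasDerivAt F (-f ξ) ξ)
    (hK : ∀ ξ ∈ Set.Icc (-β) β, |f ξ| ≤ K ∧ |deriv f ξ| ≤ K)
    (hV : ∀ i j, V i j ∈ Set.Icc (-β) β) (hhδ : meshSize L M ^ 2 ≤ δ)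
    (hA : errorEnergy L M ε (V - restrict L M (u t)) (s - gridBulkEnergy L M F V) ≤ E * δ ^ 2) :
    gridNorm L M (V - restrict L M (u t)) + gridNormVec L M (gridGrad L M (V - restrict L M (u t)))
        + |s - bulkEnergy L F (u t)|
      ≤ (E + E / ε + (E + K * (L * E) + 2 * L ^ 2 * (K * B ^ 2 + K * B))) * δ := by
  have hK0 : 0 ≤ K := (abs_nonneg _).trans (hK _ (hV 0 0)).1
  set e := V - restrict L M (u t) with he
  set z := s - gridBulkEnergy L M F V with hz
  have hX := gridInner_self_nonneg (L := L) e
  have hY : 0 ≤ ε ^ 2 * gradSq L M e := mul_nonneg (sq_nonneg ε) (gradSq_nonneg e)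
  have hEE : E * δ ^ 2 ≤ (E * δ) ^ 2 := by
    rw [mul_pow]
    exact mul_le_mul_of_nonneg_right (by nlinarith) (sq_nonneg δ)
  rw [errorEnergy] at hA
  have b1 : gridNorm L M e ≤ E * δ :=
    Real.sqrt_le_iff.2 ⟨by positivity, by linarith [sq_nonneg z]⟩
  have b2 : gridNormVec L M (gridGrad L M e) ≤ E / ε * δ := by
    refine Real.sqrt_le_iff.2 ⟨by positivity, ?_⟩
    have e1 : (E / ε * δ) ^ 2 = (E * δ) ^ 2 / ε ^ 2 := by field_simp
    rw [e1, le_div_iff₀ (by positivity), mul_comm]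
    change ε ^ 2 * gradSq L M e ≤ _
    linarith [sq_nonneg z]
  have b3 : |z| ≤ E * δ := abs_le_of_sq_le_sq (by linarith) (by positivity)
  have b4 : |gridBulkEnergy L M F V - gridBulkEnergy L M F (restrict L M (u t))|
      ≤ K * (L * (E * δ)) := by
    rw [gridBulkEnergy_eq_gridSum, gridBulkEnergy_eq_gridSum, ← gridSum_sub]
    calc _ ≤ gridSum L M (fun i j => K * |e i j|) :=
          (abs_gridSum_le _).trans (gridSum_mono fun i j =>
            abs_potential_sub_le hF (fun ξ hξ => (hK ξ hξ).1) (huβ t ht _) (hV i j))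
      _ = K * gridSum L M (fun i j => |e i j|) := gridSum_mul_left K fun i j => |e i j|
      _ ≤ K * (L * (E * δ)) := by
          have := (gridSum_abs_le hL.le e).trans (mul_le_mul_of_nonneg_left b1 hL.le)
          gcongr
  have b5 : |gridBulkEnergy L M F (restrict L M (u t)) - bulkEnergy L F (u t)|
      ≤ 2 * L ^ 2 * (K * B ^ 2 + K * B) * δ := by
    rw [abs_sub_comm]
    exact (abs_bulkEnergy_sub_gridBulkEnergy_le hL hB0 (hu.space_contDiff t ht)
      (hsol.periodic t ht) (huβ t ht) (fun x hx => (hB t ht x hx).2) hf hF hK).trans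
      (mul_le_mul_of_nonneg_left hhδ (by positivity))
  have b6 : |s - bulkEnergy L F (u t)| ≤ |z|
      + |gridBulkEnergy L M F V - gridBulkEnergy L M F (restrict L M (u t))|
      + |gridBulkEnergy L M F (restrict L M (u t)) - bulkEnergy L F (u t)| := by
    have e1 : s - bulkEnergy L F (u t)
        = z + (gridBulkEnergy L M F V - gridBulkEnergy L M F (restrict L M (u t)))
          + (gridBulkEnergy L M F (restrict L M (u t)) - bulkEnergy L F (u t)) := by rw [hz]; ring
    rw [e1]
    exact abs_add_three _ _ _
  linarith

end Scheme

end SESAV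

theorem mainTheorem3
    (L T ε κ Cstar K : ℝ) (hL : 0 < L) (hT : 0 < T) (hε : 0 < ε) (hCstar : 0 ≤ Cstar)
    (uinit : SESAV.Plane → ℝ) (u : ℝ → SESAV.Plane → ℝ)
    (hu : SESAV.IsSmoothEnough T u) :
    ∃ C > 0, ∀ (β : ℝ) (f F : ℝ → ℝ),
      0 < β →
      (∀ ξ ∈ Set.Icc (-β) β, ContDiffAt ℝ 1 f ξ) →
      (∀ ξ ∈ Set.Icc (-β) β, HasDerivAt F (-f ξ) ξ) →
      f β ≤ 0 → 0 ≤ f (-β) →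
      (∀ ξ ∈ Set.Icc (-β) β, |f ξ| ≤ K ∧ |deriv f ξ| ≤ K) →
      (∀ ξ ∈ Set.Icc (-β) β, |deriv f ξ| ≤ κ) →
      (∀ ξ ∈ Set.Icc (-β) β, -Cstar ≤ L ^ 2 * F ξ) →
      (∀ x, |uinit x| ≤ β) →
      SESAV.IsSolution L T ε f uinit u →
      ∃ τ₀ > 0, ∃ h₀ > 0, ∀ (M : ℕ) [NeZero M] (τ : ℝ),
        0 < τ → τ ≤ τ₀ → SESAV.meshSize L M ≤ h₀ →
        ∀ (U : ℕ → SESAV.Grid M) (S : ℕ → ℝ),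
          SESAV.IsSESAV1 L M ε κ τ f F uinit U S →
          ∀ n ≤ ⌊T / τ⌋₊,
            SESAV.gridNorm L M (U n - SESAV.restrict L M (u (n * τ)))
              + SESAV.gridNormVec L M
                  (SESAV.gridGrad L M (U n - SESAV.restrict L M (u (n * τ))))
              + |S n - SESAV.bulkEnergy L F (u (n * τ))|
            ≤ C * (τ + SESAV.meshSize L M ^ 2) := by
  obtain ⟨B, hB0, hB⟩ := hu.exists_isDerivBound L
  -- `K` enters through `|K|`: its sign is only known once a nonlinearity is given, after `C`
  have hc₁ : 0 ≤ SESAV.sourceConst L ε κ |K| B := SESAV.sourceConst_nonneg _ _ _ _ _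
  have hc₂ : 1 ≤ SESAV.defectConst L |K| B := SESAV.one_le_defectConst hL (abs_nonneg K) hB0
  set c₁ := SESAV.sourceConst L ε κ |K| B with hc₁def
  set c₂ := SESAV.defectConst L |K| B with hc₂def
  set c := c₁ + 4 + 15 * c₂ ^ 2 with hc
  have hc0 : 0 ≤ c := by positivity
  set E := Real.exp (c * T) with hE
  have hE1 : 1 ≤ E := Real.one_le_exp (by positivity)
  refine ⟨E + E / ε + (E + |K| * (L * E) + 2 * L ^ 2 * (|K| * B ^ 2 + |K| * B)), by positivity, ?_⟩
  intro β f F hβ hf hF h₁ h₂ hK hκ _ hinit hsol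
  have hκ0 : 0 ≤ κ := (abs_nonneg _).trans (hκ β ⟨by linarith, le_rfl⟩)
  replace hK : ∀ ξ ∈ Set.Icc (-β) β, |f ξ| ≤ |K| ∧ |deriv f ξ| ≤ |K| := fun ξ hξ =>
    ⟨(hK ξ hξ).1.trans (le_abs_self K), (hK ξ hξ).2.trans (le_abs_self K)⟩
  have huβ := hsol.mem_Icc hu hL hβ hf h₁ h₂ hinit
  -- the steps must be small enough for the one-step estimate and for `E (τ + h²)² ≤ 1`
  refine ⟨min (1 / (2 * E)) (min (1 / (5 * c₁ + 1)) (1 / (64 * c₂ ^ 2))), by positivity,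
    1 / (2 * E), by positivity, ?_⟩
  intro M _ τ hτ hτ₀ hh₀ U S hUS n hn
  have hh := SESAV.meshSize_pos (M := M) hL
  have hτE : τ ≤ 1 / (2 * E) := hτ₀.trans (min_le_left _ _)
  have hτ₁ : τ * (5 * c₁ + 1) ≤ 1 :=
    (le_div_iff₀ (by positivity)).1 (hτ₀.trans ((min_le_right _ _).trans (min_le_left _ _)))
  have hτ₂ : τ * (64 * c₂ ^ 2) ≤ 1 :=
    (le_div_iff₀ (by positivity)).1 (hτ₀.trans ((min_le_right _ _).trans (min_le_right _ _)))
  set h := SESAV.meshSize L M with hhdef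
  have hE2 : 1 / (2 * E) ≤ 1 := by
    rw [div_le_one (by positivity)]; linarith
  have hhE : h ^ 2 ≤ 1 / (2 * E) := by
    have : h ^ 2 ≤ h := by nlinarith
    linarith
  have hδ : τ + h ^ 2 ≤ 1 / E := by
    have : 1 / E = 1 / (2 * E) + 1 / (2 * E) := by field_simp; norm_num
    linarith
  have hδ0 : 0 ≤ τ + h ^ 2 := by positivity
  have hEδ : E * (τ + h ^ 2) ≤ 1 := by
    rw [mul_comm]; exact (le_div_iff₀ (by positivity)).1 hδ
  have hδ1 : τ + h ^ 2 ≤ 1 := by nlinarith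
  have hsmall : E * (τ + h ^ 2) ^ 2 ≤ 1 := by nlinarith
  have hU := hUS.abs_le hτ hβ hf hκ h₁ h₂ hinit
  have hA := SESAV.bootstrap_gronwall (T := T)
    (A := fun n : ℕ => SESAV.errorEnergy L M ε (U n - SESAV.restrict L M (u (n * τ)))
      (S n - SESAV.gridBulkEnergy L M F (U n))) hc0 hτ.le
    (by
      have e : U 0 - SESAV.restrict L M (u ((0 : ℕ) * τ)) = 0 := by
        rw [hUS.init_u, Nat.cast_zero, zero_mul, hsol.initial, sub_self]
      simp only [e, hUS.init_s, sub_self]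
      simp [SESAV.errorEnergy, SESAV.gradSq, SESAV.gridInner, SESAV.gridGrad])
    hsmall (sq_nonneg _)
    (fun n hn hA => by
      have e : ((n + 1 : ℕ) : ℝ) * τ = n * τ + τ := by push_cast; ring
      simp only [e]
      exact hUS.errorEnergy_succ_le hL hT hτ hκ0 hB0 hu hB hsol huβ hf hF hK hU (by linarith)
        hτ₁ hτ₂ n (by linarith) hA)
  have hnT : n * τ ≤ T :=
    (le_div_iff₀ hτ).1 ((Nat.le_floor_iff (by positivity)).1 hn)
  exact SESAV.error_le_of_errorEnergy_le hL hε hB0 hE1 hδ0 ⟨by positivity, hnT⟩ hu hB hsol huβ hf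
    hF hK (hU n) (by linarith) (hA n hnT)
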